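/- Let $r>2$ and $0\le k<n$ be integers, and let $S$ be the set of vectors $x\in\{0,1,\dots,r-1\}^n$ with exactly $k$ nonzero entries. Put $\mathcal D=\{(i,j)\in\mathbb N^2 : i+j\le k,\ 0\le j\le \min(k,n-k)\}$. For $x,y\in S$ let $e(x,y)=|\{l: x_l=y_l\ne 0\}|$ and $c(x,y)=|\{l: x_l\neq 0,\ y_l\ne 0\}|$, and let $\mathcal R(x,y)=(i,j)\in\mathcal D$ be determined by $e(x,y)=k-i-j$, $c(x,y)=k-j$. The pair $J_r(n,k)=(S,\mathcal R)$ is the nonbinary Johnson scheme; $A_{ij}$ denotes the $0/1$ adjacency matrix of $\mathcal R^{-1}(i,j)$. Define $$K_i(N,q;x)=\sum_{u=0}^i(-1)^u(q-1)^{i-u}\binom xu\binom{N-x}{i-u},$$ $$H_j(N,p;y)=\frac{\binom Nj-\binom N{j-1}}{\binom py\binom{N-p}y}\sum_{u=0}^y(-1)^u\binom ju\binom{p-j}{y-u}\binom{N-p-j}{y-u},$$ with $\binom N{-1}=0$ and $H_j(N,p;y)=0$ for $y>\min(p,N-p)$, and for $(i,j),(x,y)\in\mathcal D$ put $$Q_{ij}(xy)=\frac{\binom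 ni}{\binom ki}K_i(k-y,r-1;x)\,H_j(n-i,k-i;y),\qquad E_{ij}=\frac1{|S|}\sum_{(x,y)\in\mathcal D}Q_{ij}(xy)\,A_{xy}.$$ Then $J_r(n,k)$ is a symmetric association scheme, the matrices $E_{ij}$, $(i,j)\in\mathcal D$, are pairwise distinct and are exactly the primitive idempotents of its Bose–Mesner algebra $\mathrm{span}_{\mathbb C}\{A_{xy}\}$, and there are unique real numbers $q^{st}_{uv,ij}$ (the Krein numbers) with $$(|S|E_{uv})\circ(|S|E_{ij})=\sum_{(s,t)\in\mathcal D}q^{st}_{uv,ij}\,|S|E_{st}\qquad((u,v),(i,j)\in\mathcal D),$$ where $\circ$ is the entrywise product. Let $\le_{\mathrm{grlex}}$ be the order on $\mathbb N^2$ that first compares $i+j$ and then compares lexicographically, first entry first. The Krein numbers satisfy the following, for $(i,j),(s,t)\in\mathcal D$. (i) Suppose $(1,0)\in\mathcal D$. If $q^{st}_{10,ij}\ne0$, then $(s,t)\in\{(i+1,j),(i+1,j-1),(i,j),(i-1,j+1),(i-1,j)\}\cap\mathcal D$, and $(s,t)\le_{\mathrm{grlex}}(i+1,j)$. Whenever the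 upper index lies in $\mathcal D$, $$q^{ij}_{10,ij}=\frac{ni(r-3)}k,\quad q^{i+1,j}_{10,ij}=\frac{n(i+1)(k-i-j)}{k(n-i-2j)},\quad q^{i+1,j-1}_{10,ij}=\frac{n(i+1)(n-k-j+1)}{k(n-i-2j+2)},$$ $$q^{i-1,j}_{10,ij}=\frac{n(r-2)(n-i-j+2)(k-i-j+1)}{k(n-i-2j+2)},\quad q^{i-1,j+1}_{10,ij}=\frac{n(r-2)(j+1)(n-k-j)}{k(n-i-2j)}.$$ Moreover, if $(i+1,j)\in\mathcal D$, then $q^{i+1,j}_{10,ij}\ne0$. (ii) Suppose $(0,1)\in\mathcal D$. If $q^{st}_{01,ij}\ne0$, then $(s,t)\in\{(i,j+1),(i,j),(i,j-1)\}\cap\mathcal D$, and $(s,t)\le_{\mathrm{grlex}}(i,j+1)$. Whenever the upper index lies in $\mathcal D$, $$q^{ij}_{01,ij}=n-1-\frac{n(n-1)}{k(n-k)(n-i-2j+1)}\left(\frac{(k-i-j)(n-i-j+1)(n-k-j)}{n-i-2j}+\frac{j(k-i-j+1)(n-k-j+1)}{n-i-2j+2}\right),$$ $$q^{i,j-1}_{01,ij}=\frac{n(n-1)(k-i-j+1)(n-i-j+2)(n-k-j+1)}{k(n-k)(n-i-2j+2)(n-i-2j+3)},\quad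 q^{i,j+1}_{01,ij}=\frac{n(n-1)(j+1)(k-i-j)(n-k-j)}{k(n-k)(n-i-2j)(n-i-2j-1)},$$ where the first fraction inside the parentheses is read as $0$ when $n=i+2j$ (its numerator then vanishes as well). Moreover, if $(i,j+1)\in\mathcal D$, then $q^{i,j+1}_{01,ij}\ne0$. -/

import Mathlib

open scoped Matrix

namespace NonbinaryJohnson

/-! ### Association schemes -/

section Scheme

variable {X I J : Type*} [Fintype X] [DecidableEq X] [Fintype I] [DecidableEq I] [Fintype J]

/-- The adjacency matrix `A_i` of the relation `{(x, y) | R x y = i}`. -/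
def adjacency (R : X → X → I) (i : I) : Matrix X X ℂ :=
  Matrix.of fun x y => if R x y = i then 1 else 0

/-- The pair `(X, R)` is a symmetric (in particular commutative) association scheme: `R` is
surjective, some `A_i` is the identity, every `A_i` is symmetric, and the products `A_i A_j` are
linear combinations of the adjacency matrices and commute. -/
structure IsSymmetricAssociationScheme (R : X → X → I) : Prop where
  surjective : ∀ i, ∃ x y, R x y = i
  identity : ∃ i, adjacency R i = 1
  symmetric : ∀ i, (adjacency R i)ᵀ = adjacency R i
  mul : ∀ i j, ∃ p : I → ℂ, adjacency R i * adjacency R j = ∑ l, p l • adjacency R l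
  comm : ∀ i j, adjacency R i * adjacency R j = adjacency R j * adjacency R i

/-- The Bose-Mesner algebra: the complex span of the adjacency matrices. -/
def boseMesner (R : X → X → I) : Submodule ℂ (Matrix X X ℂ) :=
  Submodule.span ℂ (Set.range (adjacency R))

/-- `e` is a primitive idempotent of the (commutative) algebra whose underlying space is `V`: a
nonzero idempotent of `V` such that every idempotent `f` of `V` below `e` is `0` or `e`. -/
def IsPrimitiveIdempotentOf (V : Submodule ℂ (Matrix X X ℂ)) (e : Matrix X X ℂ) : Prop :=
  e ∈ V ∧ e ≠ 0 ∧ e * e = e ∧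
    ∀ f ∈ V, f * f = f → e * f = f → f * e = f → f = 0 ∨ f = e

/-- `E` is an enumeration without repetition of all primitive idempotents of the Bose-Mesner
algebra of `(X, R)`. -/
def EnumeratesPrimitiveIdempotents (R : X → X → I) (E : J → Matrix X X ℂ) : Prop :=
  Function.Injective E ∧ ∀ e, IsPrimitiveIdempotentOf (boseMesner R) e ↔ ∃ a, E a = e

/-- `q a b c` (written `q^c_{ab}`) are the Krein numbers with respect to the matrices `E`:
`(|X| E_a) ∘ (|X| E_b) = ∑_c q^c_{ab} |X| E_c` for the entrywise product `∘`. -/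
def IsKreinNumbers (E : J → Matrix X X ℂ) (q : J → J → J → ℝ) : Prop :=
  ∀ a b, Matrix.hadamard ((Fintype.card X : ℂ) • E a) ((Fintype.card X : ℂ) • E b) =
    ∑ c, ((q a b c : ℝ) : ℂ) • ((Fintype.card X : ℂ) • E c)

end Scheme

/-! ### The nonbinary Johnson scheme -/

/-- The weight of a vector: its number of nonzero entries. -/
def weight {n r : ℕ} (x : Fin n → Fin r) : ℕ :=
  (Finset.univ.filter fun l => (x l).val ≠ 0).card

/-- The vectors of length `n` over `{0, …, r - 1}` of weight `k`. -/
abbrev Vertex (r n k : ℕ) : Type := {x : Fin n → Fin r // weight x = k}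

/-- The number `e(x, y)` of equal nonzero entries. -/
def equalNonzero {n r : ℕ} (x y : Fin n → Fin r) : ℕ :=
  (Finset.univ.filter fun l => x l = y l ∧ (y l).val ≠ 0).card

/-- The number `c(x, y)` of common nonzero entries. -/
def commonNonzero {n r : ℕ} (x y : Fin n → Fin r) : ℕ :=
  (Finset.univ.filter fun l => (x l).val ≠ 0 ∧ (y l).val ≠ 0).card

/-- The index set `𝒟 = {(i, j) | i + j ≤ k, 0 ≤ j ≤ min k (n - k)}` (used for `k ≤ n`). -/
def domain (n k : ℕ) : Finset (ℕ × ℕ) :=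
  (Finset.range (k + 1) ×ˢ Finset.range (k + 1)).filter
    fun a => a.1 + a.2 ≤ k ∧ a.2 ≤ min k (n - k)

theorem mem_domain {n k i j : ℕ} : (i, j) ∈ domain n k ↔ i + j ≤ k ∧ j ≤ min k (n - k) := by
  simp only [domain, Finset.mem_filter, Finset.mem_product, Finset.mem_range]
  omega

theorem equalNonzero_le {n r : ℕ} (x y : Fin n → Fin r) :
    equalNonzero x y ≤ commonNonzero x y := by
  apply Finset.card_le_card
  intro l
  simp only [Finset.mem_filter, Finset.mem_univ, true_and]
  rintro ⟨h, h'⟩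
  exact ⟨h ▸ h', h'⟩

theorem commonNonzero_le {n r : ℕ} (x y : Fin n → Fin r) : commonNonzero x y ≤ weight x := by
  apply Finset.card_le_card
  intro l
  simp only [Finset.mem_filter, Finset.mem_univ, true_and]
  exact fun h => h.1

theorem weight_add_weight_le {n r : ℕ} (x y : Fin n → Fin r) :
    weight x + weight y ≤ n + commonNonzero x y := by
  have h := Finset.card_union_add_card_inter (Finset.univ.filter fun l => (x l).val ≠ 0)
    (Finset.univ.filter fun l => (y l).val ≠ 0)
  have h' := Finset.card_le_univ ((Finset.univ.filter fun l => (x l).val ≠ 0) ∪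
    (Finset.univ.filter fun l => (y l).val ≠ 0))
  rw [← Finset.filter_and] at h
  rw [Fintype.card_fin] at h'
  unfold weight commonNonzero
  omega

/-- The map `ℛ : S × S → 𝒟`: `ℛ(x, y) = (i, j)` with `c(x, y) = k - j` and
`e(x, y) = k - i - j`, that is, `i = c(x, y) - e(x, y)` and `j = k - c(x, y)`. -/
def relation (r n k : ℕ) (x y : Vertex r n k) : domain n k :=
  ⟨(commonNonzero x.1 y.1 - equalNonzero x.1 y.1, k - commonNonzero x.1 y.1), by
    have h1 := commonNonzero_le x.1 y.1
    have h2 := weight_add_weight_le x.1 y.1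
    rw [x.2] at h1 h2
    rw [y.2] at h2
    rw [mem_domain]
    omega⟩

/-- The defining property of `relation`, in the form `e = k - i - j` and `c = k - j`. -/
theorem relation_eq_iff {r n k : ℕ} (x y : Vertex r n k) (a : domain n k) :
    relation r n k x y = a ↔
      (equalNonzero x.1 y.1 : ℤ) = (k : ℤ) - a.1.1 - a.1.2 ∧
        (commonNonzero x.1 y.1 : ℤ) = (k : ℤ) - a.1.2 := by
  obtain ⟨⟨i, j⟩, ha⟩ := a
  have h1 := commonNonzero_le x.1 y.1
  have h2 := equalNonzero_le x.1 y.1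
  rw [x.2] at h1
  rw [mem_domain] at ha
  simp only [relation, Subtype.mk.injEq, Prod.mk.injEq]
  omega

/-! ### The second eigenmatrix and the primitive idempotents -/

/-- The Krawtchouk polynomial `K_i(n, q; j)`. -/
def krawtchouk (i n q j : ℕ) : ℝ :=
  ∑ u ∈ Finset.range (i + 1),
    (-1 : ℝ) ^ u * ((q : ℝ) - 1) ^ (i - u) * (j.choose u : ℝ) * ((n - j).choose (i - u) : ℝ)

/-- The Eberlein polynomial `E_i(n, k; j)` (used for `j ≤ min k (n - k)`). -/
def eberlein (i n k j : ℕ) : ℝ :=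
  ∑ u ∈ Finset.range (i + 1),
    (-1 : ℝ) ^ u * (j.choose u : ℝ) * ((k - j).choose (i - u) : ℝ) *
      ((n - k - j).choose (i - u) : ℝ)

/-- The Hahn polynomial `H_i(n, k; j)`. Here `binom n (i - 1)` is `0` for `i = 0`, and the value is
`0` for `j > min k (n - k)`, where the denominator vanishes. -/
noncomputable def hahn (i n k j : ℕ) : ℝ :=
  ((n.choose i : ℝ) - (if i = 0 then 0 else (n.choose (i - 1) : ℝ))) /
      ((k.choose j : ℝ) * ((n - k).choose j : ℝ)) * eberlein j n k i

/-- The entries `Q_{ij}(x y) = binom n i / binom k i * K_i(k - y, r - 1; x) * H_j(n - i, k - i; y)`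
of the second eigenmatrix, for `a = (i, j)` and `b = (x, y)`. -/
noncomputable def secondEigenmatrix (r n k : ℕ) (a b : ℕ × ℕ) : ℝ :=
  (n.choose a.1 : ℝ) / (k.choose a.1 : ℝ) * krawtchouk a.1 (k - b.2) (r - 1) b.1 *
    hahn a.2 (n - a.1) (k - a.1) b.2

/-- The matrices `E_{ij}`, given by `|S| E_{ij} = ∑_{(x, y) ∈ 𝒟} Q_{ij}(x y) A_{xy}`. -/
noncomputable def idempotent (r n k : ℕ) (a : domain n k) :
    Matrix (Vertex r n k) (Vertex r n k) ℂ :=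
  (Fintype.card (Vertex r n k) : ℂ)⁻¹ •
    ∑ b : domain n k, ((secondEigenmatrix r n k a b : ℝ) : ℂ) • adjacency (relation r n k) b

/-- The graded lexicographic order on `ℕ²`: compare total degrees, then the leftmost entries at
which the two pairs differ. -/
def GrlexLE (a b : ℕ × ℕ) : Prop :=
  a.1 + a.2 < b.1 + b.2 ∨ (a.1 + a.2 = b.1 + b.2 ∧ (a.1 < b.1 ∨ (a.1 = b.1 ∧ a.2 ≤ b.2)))

end NonbinaryJohnson

open NonbinaryJohnson

namespace NonbinaryJohnson
open Finset

/-! On the `r - 1` nonzero symbols the kernel `(r - 1) [a = b] - 1` is `r - 1` times the projection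
onto functions of sum zero. Up to `binom n i / binom k i`, the value of `Q_{ij}` at a pair of
vectors with supports `X`, `Y` is a sum over the `i`-sets `U ⊆ X ∩ Y` of the product of these
kernels over `U` (an elementary symmetric function, hence the Krawtchouk factor), times a Hahn
polynomial in `#(X \ Y)`, the idempotent kernel of the Johnson scheme of `k`-sets containing `U`. In
a product of two such matrices, different `U` annihilate each other coordinatewise, and equal `U`
leave the orthogonality of the Johnson idempotents (`sum_hahn_mul_hahn`), which comes from the
distinct eigenvalues of the Johnson graph and from `sum_hahn`. By `sum_secondEigenmatrix_mul` the
`E_{ij}` are then `|𝒟|` nonzero orthogonal idempotents in a space spanned by `|𝒟|` adjacency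
matrices. They form a basis, and all claims about the scheme and its idempotents are linear algebra.

The Krein numbers are the unique coefficients expanding an entrywise product of two rows of `Q` in
the rows of `Q`. Row `(1, 0)` is `n / k * K_1`, and `K_1 K_i` is a combination of `K_{i+1}`, `K_i`,
`K_{i-1}`. Rows with first index `i ± 1` carry Hahn polynomials with shifted parameters, so `H_j(n -
i, k - i; y)` is re-expanded: by `hahn_down` for `i + 1`, and by `hahn_up` for `i - 1`, whose factor
`p + 1 - y` is supplied by the Krawtchouk recurrence. This gives two terms on each side. Row `(0,
1)` is affine in `y`, and multiplication by `y` is the three-term Hahn recurrence, the composite of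
`hahn_up` and `hahn_down`. Both relations are contiguous relations for `diagCoeff`. -/

/-! ### Contiguous relations and difference equation for Eberlein sums -/

theorem sum_antidiagonal_fst_mul (g : ℕ → ℕ → ℝ) (y : ℕ) :
    ∑ p ∈ antidiagonal (y + 1), (p.1 : ℝ) * g p.1 p.2 =
      ∑ p ∈ antidiagonal y, ((p.1 : ℝ) + 1) * g (p.1 + 1) p.2 := by
  rw [Finset.Nat.sum_antidiagonal_succ]
  simp

theorem sum_antidiagonal_snd_mul (g : ℕ → ℕ → ℝ) (y : ℕ) :
    ∑ p ∈ antidiagonal (y + 1), (p.2 : ℝ) * g p.1 p.2 =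
      ∑ p ∈ antidiagonal y, ((p.2 : ℝ) + 1) * g p.1 (p.2 + 1) := by
  rw [Finset.Nat.sum_antidiagonal_succ']
  simp

theorem succ_mul_choose_succ (m u : ℕ) :
    ((u : ℝ) + 1) * (m.choose (u + 1) : ℝ) = ((m : ℝ) - u) * (m.choose u : ℝ) := by
  rcases le_or_gt u m with h | h
  · have := Nat.choose_succ_right_eq m u
    rw [← Nat.cast_sub h, mul_comm, mul_comm ((m - u : ℕ) : ℝ)]
    exact_mod_cast this
  · rw [Nat.choose_eq_zero_of_lt h, Nat.choose_eq_zero_of_lt (by omega)]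
    simp

theorem mul_choose_pred (m u : ℕ) :
    (m : ℝ) * ((m - 1).choose u : ℝ) = ((m : ℝ) - u) * (m.choose u : ℝ) := by
  rw [← succ_mul_choose_succ]
  rcases m with _ | m
  · simp
  · have := Nat.add_one_mul_choose_eq m u
    rw [mul_comm ((u : ℝ) + 1)]
    exact_mod_cast this

/-- The coefficient of `(s t) ^ y` in `(1 - s t) ^ m * (1 + s) ^ a * (1 + t) ^ b`. -/
def diagCoeff (m a b y : ℕ) : ℝ :=
  ∑ p ∈ antidiagonal y, ((-1) ^ p.1 * (m.choose p.1 : ℝ)) * ((a.choose p.2 : ℝ) * (b.choose p.2 : ℝ))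

/-- The index `j` now enters only through three exponents, so relations between neighbouring
exponents relate neighbouring `j`, `N` and `p`. -/
theorem eberlein_eq_diagCoeff (y N p j : ℕ) :
    eberlein y N p j = diagCoeff j (p - j) (N - p - j) y := by
  rw [diagCoeff, Finset.Nat.sum_antidiagonal_eq_sum_range_succ
    (fun u w => ((-1) ^ u * (j.choose u : ℝ)) *
      (((p - j).choose w : ℝ) * ((N - p - j).choose w : ℝ)))]
  exact Finset.sum_congr rfl fun u _ => by ring

theorem diagCoeff_swap (m a b y : ℕ) : diagCoeff m a b y = diagCoeff m b a y :=
  Finset.sum_congr rfl fun _ _ => by ring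

theorem diagCoeff_zero (m a b : ℕ) : diagCoeff m a b 0 = 1 := by simp [diagCoeff]

theorem diagCoeff_eq_zero {m a b y : ℕ} (h : a + m < y) : diagCoeff m a b y = 0 := by
  refine Finset.sum_eq_zero fun p hp => ?_
  rw [HasAntidiagonal.mem_antidiagonal] at hp
  rcases lt_or_ge m p.1 with h' | h'
  · simp [Nat.choose_eq_zero_of_lt h']
  · simp [Nat.choose_eq_zero_of_lt (show a < p.2 by omega)]

/-- Multiplication of the generating function by `1 - s t`. -/
theorem diagCoeff_succ (m a b y : ℕ) :
    diagCoeff (m + 1) a b (y + 1) = diagCoeff m a b (y + 1) - diagCoeff m a b y := by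
  rw [diagCoeff, diagCoeff, diagCoeff, Finset.Nat.sum_antidiagonal_succ,
    Finset.Nat.sum_antidiagonal_succ, add_sub_assoc, ← Finset.sum_sub_distrib]
  simp only [Nat.choose_succ_succ, Nat.cast_add, Nat.choose_zero_right]
  congr 1
  exact Finset.sum_congr rfl fun p _ => by ring

/-- Once `diagCoeff_succ` removes the exponent `m + 1`, the relation holds term by term: the `C(a,
w) C(b, w)` parts have weights `a + 1 + w` and `b - w`, and the `C(a, w - 1)` parts cancel. -/
theorem diagCoeff_up (m a b y : ℕ) :
    ((a : ℝ) + b + 1) * diagCoeff m a b y =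
      ((a : ℝ) + 1) * diagCoeff m (a + 1) b y + b * diagCoeff (m + 1) a (b - 1) y := by
  rcases y with _ | y
  · simp only [diagCoeff_zero]; ring
  -- The coefficient at `y` is moved to the antidiagonal of `y + 1`, so that all sums have the same
  -- index set.
  have key : (b : ℝ) * diagCoeff m a (b - 1) y =
      ∑ p ∈ antidiagonal (y + 1), (p.2 : ℝ) * (((-1) ^ p.1 * (m.choose p.1 : ℝ)) *
        ((a.choose (p.2 - 1) : ℝ) * (b.choose p.2 : ℝ))) := by
    rw [sum_antidiagonal_snd_mul (fun u w => ((-1) ^ u * (m.choose u : ℝ)) *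
        ((a.choose (w - 1) : ℝ) * (b.choose w : ℝ))), diagCoeff, Finset.mul_sum]
    refine Finset.sum_congr rfl fun p _ => ?_
    have h1 := mul_choose_pred b p.2
    have h2 := succ_mul_choose_succ b p.2
    rw [Nat.add_sub_cancel]
    linear_combination ((-1) ^ p.1 * (m.choose p.1 : ℝ) * (a.choose p.2 : ℝ)) * (h1 - h2)
  rw [diagCoeff_succ, mul_sub, key, diagCoeff, diagCoeff, diagCoeff, Finset.mul_sum,
    Finset.mul_sum, Finset.mul_sum, ← Finset.sum_sub_distrib, ← Finset.sum_add_distrib]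
  refine Finset.sum_congr rfl fun p _ => ?_
  have h1 := mul_choose_pred b p.2
  have h2 : ((a : ℝ) + 1) * ((a + 1).choose p.2 : ℝ) =
      ((a : ℝ) + 1 + p.2) * (a.choose p.2 : ℝ) + p.2 * (a.choose (p.2 - 1) : ℝ) := by
    rcases p.2 with _ | w
    · simp
    · have h3 := succ_mul_choose_succ a w
      rw [Nat.choose_succ_succ, Nat.add_sub_cancel]
      push_cast
      linear_combination -h3
  linear_combination (-((-1) ^ p.1 * (m.choose p.1 : ℝ))) * ((a.choose p.2 : ℝ) * h1 +
    (b.choose p.2 : ℝ) * h2)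

/-- Writing `a + m - y = (a - w) + (m - u)` lowers `a` or `m`; `diagCoeff_up` with `a` and `b`
exchanged then eliminates the coefficient with exponents `m - 1`, `a`, `b`. -/
theorem diagCoeff_down (m a b y : ℕ) :
    ((a : ℝ) + b + 1) * (((a : ℝ) + m - y) * diagCoeff m a b y) =
      a * ((a : ℝ) + b + m + 1) * diagCoeff m (a - 1) b y +
        m * ((b : ℝ) + 1) * diagCoeff (m - 1) a (b + 1) y := by
  have h1 : ((a : ℝ) + m - y) * diagCoeff m a b y =
      a * diagCoeff m (a - 1) b y + m * diagCoeff (m - 1) a b y := by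
    rw [diagCoeff, diagCoeff, diagCoeff, Finset.mul_sum,
      Finset.mul_sum, Finset.mul_sum, ← Finset.sum_add_distrib]
    refine Finset.sum_congr rfl fun p hp => ?_
    have hy : (y : ℝ) = p.1 + p.2 := by
      rw [HasAntidiagonal.mem_antidiagonal] at hp
      exact_mod_cast hp.symm
    have h2 := mul_choose_pred a p.2
    have h3 := mul_choose_pred m p.1
    rw [hy]
    linear_combination (-((-1) ^ p.1 * (b.choose p.2 : ℝ))) * ((m.choose p.1 : ℝ) * h2 +
      (a.choose p.2 : ℝ) * h3)
  rw [h1]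
  rcases m with _ | m
  · push_cast; ring
  · have h2 := diagCoeff_up m b a y
    rw [diagCoeff_swap m b a, diagCoeff_swap m (b + 1) a, diagCoeff_swap (m + 1) b] at h2
    rw [Nat.add_sub_cancel]
    push_cast
    linear_combination ((m : ℝ) + 1) * h2

/-- The ratio of consecutive `c u` is linear and that of consecutive `A w` quadratic. With matching
polynomial weights all three sums move to the antidiagonal of `y + 1`, where a polynomial identity
remains. -/
theorem diagCoeff_difference (m a b y : ℕ) :
    ((y : ℝ) + 1 + 1) ^ 2 * diagCoeff m a b (y + 1 + 1) +
      ((a : ℝ) + m - y) * ((b : ℝ) + m - y) * diagCoeff m a b y +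
      ((y : ℝ) + 1) * ((a : ℝ) + m - (y + 1) + (b + m - (y + 1))) * diagCoeff m a b (y + 1) =
      ((a : ℝ) * b - m) * diagCoeff m a b (y + 1) := by
  set c : ℕ → ℝ := fun u => (-1) ^ u * (m.choose u : ℝ) with hc
  set A : ℕ → ℝ := fun w => (a.choose w : ℝ) * (b.choose w : ℝ) with hA
  have hF : ∀ z, diagCoeff m a b z = ∑ p ∈ antidiagonal z, c p.1 * A p.2 := fun z => rfl
  have hcs : ∀ u : ℕ, ((u : ℝ) + 1) * c (u + 1) = -((m : ℝ) - u) * c u := fun u => by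
    have := succ_mul_choose_succ m u
    simp only [hc, pow_succ]
    linear_combination (-(-1) ^ u) * this
  have hAs : ∀ w : ℕ, ((w : ℝ) + 1) ^ 2 * A (w + 1) = ((a : ℝ) - w) * ((b : ℝ) - w) * A w :=
    fun w => by
      have h1 := succ_mul_choose_succ a w
      have h2 := succ_mul_choose_succ b w
      simp only [hA]
      linear_combination (((w : ℝ) + 1) * (b.choose (w + 1) : ℝ)) * h1 +
        ((a : ℝ) - w) * (a.choose w : ℝ) * h2
  -- The square splits as `(u + w)^2 = u (u + 2 w) + w * w`: the factor `u` lowers `c`, and `w^2`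
  -- lowers `A`.
  have e1 : ((y : ℝ) + 1 + 1) ^ 2 * diagCoeff m a b (y + 1 + 1) =
      ∑ p ∈ antidiagonal (y + 1), (((a : ℝ) - p.2) * (b - p.2) - 2 * (m - p.1) * p.2 -
        (m - p.1) * (p.1 + 1)) * (c p.1 * A p.2) := by
    have h1 := sum_antidiagonal_fst_mul (fun u w => ((u : ℝ) + 2 * w) * (c u * A w)) (y + 1)
    have h2 := sum_antidiagonal_snd_mul (fun u w => (w : ℝ) * (c u * A w)) (y + 1)
    calc _ = ∑ p ∈ antidiagonal (y + 1 + 1), ((p.1 : ℝ) * (((p.1 : ℝ) + 2 * p.2) * (c p.1 * A p.2)) +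
          (p.2 : ℝ) * ((p.2 : ℝ) * (c p.1 * A p.2))) := by
          rw [hF, Finset.mul_sum]
          refine Finset.sum_congr rfl fun p hp => ?_
          have hy : (y : ℝ) + 1 + 1 = p.1 + p.2 := by
            rw [HasAntidiagonal.mem_antidiagonal] at hp
            exact_mod_cast hp.symm
          rw [hy]; ring
      _ = _ := by
          rw [Finset.sum_add_distrib, h1, h2, ← Finset.sum_add_distrib]
          refine Finset.sum_congr rfl fun p hp => ?_
          push_cast
          linear_combination (((p.1 : ℝ) + 1 + 2 * p.2) * A p.2) * hcs p.1 + c p.1 * hAs p.2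
  -- Here the product is split as `(a - w)(b - w) + (m - u)((a + b - 2 w) + (m - u))`: the first
  -- part raises `w`, the second raises `u`.
  have e2 : ((a : ℝ) + m - y) * ((b : ℝ) + m - y) * diagCoeff m a b y =
      ∑ p ∈ antidiagonal (y + 1), ((p.2 : ℝ) ^ 2 - p.1 * (a + b - 2 * p.2) -
        p.1 * (m - p.1 + 1)) * (c p.1 * A p.2) := by
    have h1 := sum_antidiagonal_fst_mul
      (fun u w => -(((a : ℝ) + b - 2 * w) + (m - u + 1)) * (c u * A w)) y
    have h2 := sum_antidiagonal_snd_mul (fun u w => (w : ℝ) * (c u * A w)) y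
    symm
    calc _ = ∑ p ∈ antidiagonal (y + 1), ((p.1 : ℝ) * (-(((a : ℝ) + b - 2 * p.2) + (m - p.1 + 1)) *
            (c p.1 * A p.2)) + (p.2 : ℝ) * ((p.2 : ℝ) * (c p.1 * A p.2))) :=
          Finset.sum_congr rfl fun p _ => by ring
      _ = _ := by
          rw [Finset.sum_add_distrib, h1, h2, ← Finset.sum_add_distrib, hF, Finset.mul_sum]
          refine Finset.sum_congr rfl fun p hp => ?_
          have hy : (y : ℝ) = p.1 + p.2 := by
            rw [HasAntidiagonal.mem_antidiagonal] at hp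
            exact_mod_cast hp.symm
          rw [hy]
          push_cast
          linear_combination (-(((a : ℝ) + b - 2 * p.2) + (m - p.1)) * A p.2) * hcs p.1 +
            c p.1 * hAs p.2
  rw [e1, e2, hF, Finset.mul_sum, Finset.mul_sum, ← Finset.sum_add_distrib,
    ← Finset.sum_add_distrib]
  refine Finset.sum_congr rfl fun p hp => ?_
  have hy : (y : ℝ) + 1 = p.1 + p.2 := by
    rw [HasAntidiagonal.mem_antidiagonal] at hp
    exact_mod_cast hp.symm
  rw [hy]
  ring

theorem diagCoeff_one (m a b : ℕ) : diagCoeff m a b 1 = (a : ℝ) * b - m := by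
  rw [diagCoeff, Finset.Nat.sum_antidiagonal_succ]
  simp [sub_eq_add_neg]

/-! ### Krawtchouk polynomials -/

theorem krawtchouk_eq_sum_antidiagonal (i M q x : ℕ) :
    krawtchouk i M q x = ∑ p ∈ antidiagonal i, ((-1) ^ p.1 * (x.choose p.1 : ℝ)) *
      (((q : ℝ) - 1) ^ p.2 * ((M - x).choose p.2 : ℝ)) := by
  rw [Finset.Nat.sum_antidiagonal_eq_sum_range_succ
    (fun u w => ((-1) ^ u * (x.choose u : ℝ)) * (((q : ℝ) - 1) ^ w * ((M - x).choose w : ℝ)))]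
  exact Finset.sum_congr rfl fun u _ => by ring

theorem krawtchouk_zero (M q x : ℕ) : krawtchouk 0 M q x = 1 := by simp [krawtchouk]

theorem krawtchouk_one {M x : ℕ} (h : x ≤ M) (q : ℕ) :
    krawtchouk 1 M q x = ((q : ℝ) - 1) * ((M : ℝ) - x) - x := by
  rw [krawtchouk_eq_sum_antidiagonal, Finset.Nat.sum_antidiagonal_succ]
  simp [Nat.cast_sub h]
  ring

/-- This disposes of the pairs `(i, y)` for which the Hahn relations leave their range. -/
theorem krawtchouk_eq_zero {i M x : ℕ} (hx : x ≤ M) (h : M < i) (q : ℕ) :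
    krawtchouk i M q x = 0 := by
  rw [krawtchouk_eq_sum_antidiagonal]
  refine Finset.sum_eq_zero fun p hp => ?_
  rw [HasAntidiagonal.mem_antidiagonal] at hp
  rcases lt_or_ge x p.1 with h' | h'
  · simp [Nat.choose_eq_zero_of_lt h']
  · simp [Nat.choose_eq_zero_of_lt (show M - x < p.2 by omega)]

theorem krawtchouk_at_zero (i M q : ℕ) :
    krawtchouk i M q 0 = ((q : ℝ) - 1) ^ i * (M.choose i : ℝ) := by
  rw [krawtchouk, Finset.sum_eq_single 0]
  · simp
  · intro u _ hu
    simp [Nat.choose_eq_zero_of_lt (Nat.pos_of_ne_zero hu)]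
  · simp

/-- The three-term recurrence of the Krawtchouk polynomials. -/
theorem krawtchouk_one_mul {M x : ℕ} (hx : x ≤ M) (i q : ℕ) :
    krawtchouk 1 M q x * krawtchouk i M q x =
      ((i : ℝ) + 1) * krawtchouk (i + 1) M q x + i * ((q : ℝ) - 2) * krawtchouk i M q x +
        (if i = 0 then 0 else ((q : ℝ) - 1) * ((M : ℝ) - i + 1) * krawtchouk (i - 1) M q x) := by
  set c : ℕ → ℝ := fun u => (-1) ^ u * (x.choose u : ℝ) with hc
  set A : ℕ → ℝ := fun w => ((q : ℝ) - 1) ^ w * ((M - x).choose w : ℝ) with hA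
  have hF : ∀ z, krawtchouk z M q x = ∑ p ∈ antidiagonal z, c p.1 * A p.2 :=
    fun z => krawtchouk_eq_sum_antidiagonal z M q x
  have hcs : ∀ u : ℕ, ((u : ℝ) + 1) * c (u + 1) = -((x : ℝ) - u) * c u := fun u => by
    have := succ_mul_choose_succ x u
    simp only [hc, pow_succ]
    linear_combination (-(-1) ^ u) * this
  have hAs : ∀ w : ℕ, ((w : ℝ) + 1) * A (w + 1) = ((q : ℝ) - 1) * ((M : ℝ) - x - w) * A w :=
    fun w => by
      have h1 := succ_mul_choose_succ (M - x) w
      rw [Nat.cast_sub hx] at h1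
      simp only [hA, pow_succ]
      linear_combination (((q : ℝ) - 1) ^ w * ((q : ℝ) - 1)) * h1
  -- The neighbouring degrees are moved to the antidiagonal of `i` by `i + 1 = u + w` and the ratios
  -- `hcs`, `hAs`; `K_1` is then the sum of the three weights.
  have e1 : ((i : ℝ) + 1) * krawtchouk (i + 1) M q x =
      ∑ p ∈ antidiagonal i, (-((x : ℝ) - p.1) + ((q : ℝ) - 1) * ((M : ℝ) - x - p.2)) *
        (c p.1 * A p.2) := by
    have h1 := sum_antidiagonal_fst_mul (fun u w => c u * A w) i
    have h2 := sum_antidiagonal_snd_mul (fun u w => c u * A w) i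
    calc _ = ∑ p ∈ antidiagonal (i + 1), ((p.1 : ℝ) * (c p.1 * A p.2) +
          (p.2 : ℝ) * (c p.1 * A p.2)) := by
          rw [hF, Finset.mul_sum]
          refine Finset.sum_congr rfl fun p hp => ?_
          have hy : (i : ℝ) + 1 = p.1 + p.2 := by
            rw [HasAntidiagonal.mem_antidiagonal] at hp
            exact_mod_cast hp.symm
          rw [hy]; ring
      _ = _ := by
          rw [Finset.sum_add_distrib, h1, h2, ← Finset.sum_add_distrib]
          refine Finset.sum_congr rfl fun p hp => ?_
          linear_combination (A p.2) * hcs p.1 + c p.1 * hAs p.2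
  have e2 : (if i = 0 then 0 else ((q : ℝ) - 1) * ((M : ℝ) - i + 1) * krawtchouk (i - 1) M q x) =
      ∑ p ∈ antidiagonal i, (-((q : ℝ) - 1) * p.1 + p.2) * (c p.1 * A p.2) := by
    rcases i with _ | i
    · simp
    have h1 := sum_antidiagonal_fst_mul (fun u w => -((q : ℝ) - 1) * (c u * A w)) i
    have h2 := sum_antidiagonal_snd_mul (fun u w => c u * A w) i
    rw [if_neg (by omega), Nat.add_sub_cancel]
    symm
    calc _ = ∑ p ∈ antidiagonal (i + 1), ((p.1 : ℝ) * (-((q : ℝ) - 1) * (c p.1 * A p.2)) +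
          (p.2 : ℝ) * (c p.1 * A p.2)) := Finset.sum_congr rfl fun p _ => by ring
      _ = _ := by
          rw [Finset.sum_add_distrib, h1, h2, ← Finset.sum_add_distrib, hF, Finset.mul_sum]
          refine Finset.sum_congr rfl fun p hp => ?_
          have hy : (i : ℝ) = p.1 + p.2 := by
            rw [HasAntidiagonal.mem_antidiagonal] at hp
            exact_mod_cast hp.symm
          push_cast
          rw [hy]
          linear_combination (-((q : ℝ) - 1) * A p.2) * hcs p.1 + c p.1 * hAs p.2
  rw [e1, e2, krawtchouk_one hx, hF, Finset.mul_sum, Finset.mul_sum, ← Finset.sum_add_distrib,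
    ← Finset.sum_add_distrib]
  refine Finset.sum_congr rfl fun p hp => ?_
  have hy : (i : ℝ) = p.1 + p.2 := by
    rw [HasAntidiagonal.mem_antidiagonal] at hp
    exact_mod_cast hp.symm
  rw [hy]
  ring

/-! ### Johnson multiplicities and Hahn polynomials -/

/-- The multiplicity `binom N j - binom N (j - 1)` of the Johnson scheme. -/
noncomputable def johnsonMult (j N : ℕ) : ℝ :=
  (N.choose j : ℝ) - (if j = 0 then 0 else (N.choose (j - 1) : ℝ))

theorem hahn_eq (j N p y : ℕ) : hahn j N p y =
    johnsonMult j N / ((p.choose y : ℝ) * ((N - p).choose y : ℝ)) *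
      diagCoeff j (p - j) (N - p - j) y := by
  rw [← eberlein_eq_diagCoeff]; rfl

/-- Turns the difference of binomials into a product, from which the ratios for neighbouring `j` and
`N` follow. -/
theorem johnsonMult_mul (j N : ℕ) :
    ((N : ℝ) + 1 - j) * johnsonMult j N = ((N : ℝ) + 1 - 2 * j) * (N.choose j : ℝ) := by
  rcases j with _ | j
  · simp [johnsonMult]
  · have := succ_mul_choose_succ N j
    simp only [johnsonMult, Nat.add_sub_cancel, Nat.succ_ne_zero, if_false]
    push_cast
    linear_combination this

theorem johnsonMult_pos {j N : ℕ} (h : 2 * j ≤ N) : 0 < johnsonMult j N := by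
  have h1 := johnsonMult_mul j N
  have h2 : (2 : ℝ) * j ≤ N := by exact_mod_cast h
  have h3 : (0 : ℝ) < N.choose j := by exact_mod_cast Nat.choose_pos (by omega)
  have h4 : (0 : ℝ) ≤ j := Nat.cast_nonneg j
  have h5 : 0 < ((N : ℝ) + 1 - j) * johnsonMult j N := by
    rw [h1]; exact mul_pos (by linarith) h3
  exact pos_of_mul_pos_right h5 (by linarith)

theorem johnsonMult_succ {j N : ℕ} (h : j ≤ N) :
    ((N : ℝ) + 1) * ((N : ℝ) + 2 - 2 * j) * johnsonMult j N =
      ((N : ℝ) + 1 - 2 * j) * ((N : ℝ) + 2 - j) * johnsonMult j (N + 1) := by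
  have h1 := johnsonMult_mul j N
  have h2 := johnsonMult_mul j (N + 1)
  have h3 := mul_choose_pred (N + 1) j
  have h4 : (j : ℝ) ≤ N := by exact_mod_cast h
  have h5 : (N : ℝ) + 1 - j ≠ 0 := by linarith
  rw [Nat.add_sub_cancel] at h3
  push_cast at h2 h3
  apply mul_left_cancel₀ h5
  linear_combination ((N : ℝ) + 1) * ((N : ℝ) + 2 - 2 * j) * h1 -
    ((N : ℝ) + 1 - j) * ((N : ℝ) + 1 - 2 * j) * h2 +
    ((N : ℝ) + 2 - 2 * j) * ((N : ℝ) + 1 - 2 * j) * h3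

theorem johnsonMult_succ_succ {j N : ℕ} (h : j ≤ N) :
    ((N : ℝ) + 1) * ((N : ℝ) - 2 * j) * johnsonMult j N =
      ((j : ℝ) + 1) * ((N : ℝ) + 1 - 2 * j) * johnsonMult (j + 1) (N + 1) := by
  have h1 := johnsonMult_mul j N
  have h2 := johnsonMult_mul (j + 1) (N + 1)
  have h3 : ((N : ℝ) + 1) * (N.choose j : ℝ) = ((N + 1).choose (j + 1) : ℝ) * (j + 1) := by
    exact_mod_cast Nat.add_one_mul_choose_eq N j
  have h4 : (j : ℝ) ≤ N := by exact_mod_cast h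
  have h5 : (N : ℝ) + 1 - j ≠ 0 := by linarith
  push_cast at h2
  apply mul_left_cancel₀ h5
  linear_combination ((N : ℝ) + 1) * ((N : ℝ) - 2 * j) * h1 -
    ((j : ℝ) + 1) * ((N : ℝ) + 1 - 2 * j) * h2 +
    ((N : ℝ) - 2 * j) * ((N : ℝ) + 1 - 2 * j) * h3

theorem hahn_eq_zero_of_lt_right {N p y : ℕ} (h : N - p < y) (j : ℕ) : hahn j N p y = 0 := by
  simp [hahn, Nat.choose_eq_zero_of_lt h]

theorem hahn_symm {N p : ℕ} (h : p ≤ N) (j y : ℕ) : hahn j N p y = hahn j N (N - p) y := by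
  rw [hahn_eq, hahn_eq, Nat.sub_sub_self h, diagCoeff_swap, mul_comm (p.choose y : ℝ)]

/-- This is `diagCoeff_down` with `a = p + 1 - j`, `b = N - p - j`, divided by the normalising
factors; its factor `p + 1 - y` turns `binom (p + 1) y` into `binom p y`. -/
theorem hahn_down {N p j y : ℕ} (hj : j ≤ p + 1) (hN : p + j ≤ N) (hy : y ≤ p) :
    hahn j (N + 1) (p + 1) y =
      ((p : ℝ) + 1 - j) * (N + 1) / (((N : ℝ) + 1 - 2 * j) * (p + 1)) * hahn j N p y +
        if j = 0 then 0 else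
          ((N : ℝ) - p - j + 1) * (N + 1) / (((p : ℝ) + 1) * (N + 3 - 2 * j)) *
            hahn (j - 1) N p y := by
  -- A binomial in every denominator is zero here, so all values are `0` by convention.
  by_cases hv : N - p < y
  · rw [hahn_eq_zero_of_lt_right (by omega), hahn_eq_zero_of_lt_right hv,
      hahn_eq_zero_of_lt_right hv]
    simp
  have hD := diagCoeff_down j (p + 1 - j) (N - p - j) y
  rw [Nat.cast_sub hj, Nat.cast_sub (by omega), Nat.cast_sub (by omega)] at hD
  push_cast at hD
  have h2j : (2 : ℝ) * j ≤ N + 1 := by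
    have : 2 * j ≤ N + 1 := by omega
    exact_mod_cast this
  have hV : (p.choose y : ℝ) * ((N - p).choose y : ℝ) ≠ 0 := by
    have h1 := Nat.choose_pos hy
    have h2 := Nat.choose_pos (show y ≤ N - p by omega)
    positivity
  have hp : (p : ℝ) + 1 ≠ 0 := by positivity
  have hpy : (p : ℝ) + 1 - y ≠ 0 := by
    have : (y : ℝ) ≤ p := by exact_mod_cast hy
    linarith
  have hV1 : ((p : ℝ) + 1 - y) * ((p + 1).choose y : ℝ) = (p + 1) * (p.choose y : ℝ) := by
    have := mul_choose_pred (p + 1) y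
    rw [Nat.add_sub_cancel] at this
    push_cast at this
    exact this.symm
  have hN2 : (N : ℝ) + 2 - j * 2 ≠ 0 := by linarith
  have hN3 : (N : ℝ) + 3 - j * 2 ≠ 0 := by linarith
  have hN1 : (N : ℝ) + 1 ≠ 0 := by positivity
  have hC : ((p + 1).choose y : ℝ) = (p + 1) * (p.choose y : ℝ) / ((p : ℝ) + 1 - y) := by
    field_simp
    linear_combination hV1
  have hL : hahn j (N + 1) (p + 1) y * (((p : ℝ) + 1) * ((p.choose y : ℝ) * ((N - p).choose y : ℝ)))
      = johnsonMult j (N + 1) * (((p : ℝ) + 1 - y) * diagCoeff j (p + 1 - j) (N - p - j) y) := by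
    rw [hahn_eq, hC, show N + 1 - (p + 1) = N - p by omega]
    have := left_ne_zero_of_mul hV
    have := right_ne_zero_of_mul hV
    field_simp
  -- The denominator `N + 1 - 2 j` can vanish only at `j = p + 1`, where the numerator is zero too.
  have hM1 : ((p : ℝ) + 1 - j) * (N + 1) / ((N : ℝ) + 1 - 2 * j) * johnsonMult j N =
      ((p : ℝ) + 1 - j) * ((N : ℝ) + 2 - j) / ((N : ℝ) + 2 - 2 * j) * johnsonMult j (N + 1) := by
    rcases eq_or_lt_of_le hj with rfl | hj'
    · simp
    · have h0 : (N : ℝ) + 1 - j * 2 ≠ 0 := by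
        have : 2 * j ≤ N := by omega
        have : (2 : ℝ) * j ≤ N := by exact_mod_cast this
        linarith
      have := johnsonMult_succ (show j ≤ N by omega)
      field_simp
      linear_combination ((p : ℝ) + 1 - j) * this
  have hapred : p + 1 - j - 1 = p - j := by omega
  rw [hapred] at hD
  have hR1 : ((p : ℝ) + 1 - j) * (N + 1) / (((N : ℝ) + 1 - 2 * j) * (p + 1)) * hahn j N p y *
      (((p : ℝ) + 1) * ((p.choose y : ℝ) * ((N - p).choose y : ℝ))) =
      ((p : ℝ) + 1 - j) * ((N : ℝ) + 2 - j) / ((N : ℝ) + 2 - 2 * j) * johnsonMult j (N + 1) *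
        diagCoeff j (p - j) (N - p - j) y := by
    rw [← hM1, hahn_eq, div_mul_eq_div_div]
    have := left_ne_zero_of_mul hV
    have := right_ne_zero_of_mul hV
    field_simp
  apply mul_right_cancel₀ (mul_ne_zero hp hV)
  rw [hL, add_mul _ (ite _ _ _), hR1]
  rcases j with _ | j
  · simp only [if_true, zero_mul, add_zero]
    push_cast at hD hN2 ⊢
    field_simp
    linear_combination johnsonMult 0 (N + 1) * hD
  · rw [if_neg (by omega), hahn_eq, Nat.add_sub_cancel]
    rw [Nat.add_sub_cancel, show p + 1 - (j + 1) = p - j by omega,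
      show N - p - (j + 1) + 1 = N - p - j by omega] at hD
    have hM2 := johnsonMult_succ_succ (show j ≤ N by omega)
    have := left_ne_zero_of_mul hV
    have := right_ne_zero_of_mul hV
    rw [show p + 1 - (j + 1) = p - j by omega]
    push_cast at hD hN2 hN3 ⊢
    have hM3 : johnsonMult j N = ((j : ℝ) + 1) * ((N : ℝ) + 1 - 2 * j) /
        ((N + 1) * ((N : ℝ) + 2 - 2 * (j + 1))) * johnsonMult (j + 1) (N + 1) := by
      field_simp
      linear_combination hM2
    rw [hM3]
    have hN3' : (N : ℝ) + 1 - j * 2 ≠ 0 := by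
      intro h; apply hN3; linarith
    field_simp
    linear_combination ((N : ℝ) + 3 - 2 * (j + 1)) * johnsonMult (j + 1) (N + 1) * hD

/-- This is `diagCoeff_up` with exponents `p - j` and `N - p - j`; the factor `p + 1 - y` turns
`binom p y` into `binom (p + 1) y`. -/
theorem hahn_up {N p j y : ℕ} (hj : j ≤ p) (hN : p + j ≤ N) (hy : y ≤ p + 1) :
    ((p : ℝ) + 1 - y) * hahn j N p y =
      ((p : ℝ) + 1) * (p - j + 1) * (N + 2 - j) / (((N : ℝ) + 1) * (N + 2 - 2 * j)) *
          hahn j (N + 1) (p + 1) y +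
        ((p : ℝ) + 1) * (N - p - j) * (j + 1) / (((N : ℝ) + 1) * (N - 2 * j)) *
          hahn (j + 1) (N + 1) (p + 1) y := by
  by_cases hv : N - p < y
  · rw [hahn_eq_zero_of_lt_right hv, hahn_eq_zero_of_lt_right (by omega),
      hahn_eq_zero_of_lt_right (by omega)]
    simp
  have hU := diagCoeff_up j (p - j) (N - p - j) y
  rw [Nat.cast_sub hj, Nat.cast_sub (by omega), Nat.cast_sub (by omega)] at hU
  have h2j : (2 : ℝ) * j ≤ N := by
    have : 2 * j ≤ N := by omega
    exact_mod_cast this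
  have hN2 : (N : ℝ) + 2 - j * 2 ≠ 0 := by linarith
  have hN1 : (N : ℝ) + 1 - j * 2 ≠ 0 := by linarith
  have hN0 : (N : ℝ) + 1 ≠ 0 := by positivity
  have hp : (p : ℝ) + 1 ≠ 0 := by positivity
  have hNj : (N : ℝ) + 2 - j ≠ 0 := by
    have : (0 : ℝ) ≤ j := Nat.cast_nonneg j
    linarith
  have hc1 : ((p + 1).choose y : ℝ) ≠ 0 := by
    exact_mod_cast (Nat.choose_pos hy).ne'
  have hc2 : ((N - p).choose y : ℝ) ≠ 0 := by
    exact_mod_cast (Nat.choose_pos (show y ≤ N - p by omega)).ne'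
  -- At `y = p + 1` both sides vanish, the right one because `y` exceeds `(p - j) + j`.
  have hL : ((p : ℝ) + 1 - y) * hahn j N p y = ((p : ℝ) + 1) * johnsonMult j N /
      (((p + 1).choose y : ℝ) * ((N - p).choose y : ℝ)) * diagCoeff j (p - j) (N - p - j) y := by
    rcases eq_or_lt_of_le hy with rfl | hy'
    · rw [diagCoeff_eq_zero (show p - j + j < p + 1 by omega)]
      push_cast; ring
    · have hV1 := mul_choose_pred (p + 1) y
      rw [Nat.add_sub_cancel] at hV1
      push_cast at hV1
      have : (p.choose y : ℝ) ≠ 0 := by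
        exact_mod_cast (Nat.choose_pos (show y ≤ p by omega)).ne'
      rw [hahn_eq]
      field_simp
      linear_combination (-johnsonMult j N * diagCoeff j (p - j) (N - p - j) y) * hV1
  have hM1 := johnsonMult_succ (show j ≤ N by omega)
  have hM2 := johnsonMult_succ_succ (show j ≤ N by omega)
  have hM1' : johnsonMult j (N + 1) = (N + 1) * (N + 2 - 2 * j) / ((N + 1 - 2 * j) * (N + 2 - j)) *
      johnsonMult j N := by
    have hN1' : (N : ℝ) + 1 - 2 * j ≠ 0 := by linarith
    field_simp
    linear_combination -hM1
  -- If `N = p + j`, the factor `N - p - j` is zero, whether or not `N - 2 j` is.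
  have hM2' : ((N : ℝ) - p - j) * (j + 1) / (((N : ℝ) + 1) * (N - 2 * j)) *
      johnsonMult (j + 1) (N + 1) = (N - p - j) / (N + 1 - 2 * j) * johnsonMult j N := by
    rcases eq_or_lt_of_le hN with rfl | hN'
    · push_cast; simp
    · have : (N : ℝ) - j * 2 ≠ 0 := by
        have : 2 * j + 1 ≤ N := by omega
        have : (2 : ℝ) * j + 1 ≤ N := by exact_mod_cast this
        linarith
      field_simp
      linear_combination (-((N : ℝ) - p - j)) * hM2
  rw [hL, hahn_eq, hahn_eq, show N + 1 - (p + 1) = N - p by omega,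
    show p + 1 - j = p - j + 1 by omega, show p + 1 - (j + 1) = p - j by omega,
    show N - p - (j + 1) = N - p - j - 1 by omega]
  have e : ((p : ℝ) + 1) * (N - p - j) * (j + 1) / (((N : ℝ) + 1) * (N - 2 * j)) *
      (johnsonMult (j + 1) (N + 1) / (((p + 1).choose y : ℝ) * ((N - p).choose y : ℝ)) *
        diagCoeff (j + 1) (p - j) (N - p - j - 1) y) =
      (p + 1) * ((N - p - j) / (N + 1 - 2 * j) * johnsonMult j N) /
        (((p + 1).choose y : ℝ) * ((N - p).choose y : ℝ)) *
        diagCoeff (j + 1) (p - j) (N - p - j - 1) y := by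
    rw [← hM2']; ring
  rw [e, hM1']
  field_simp
  linear_combination johnsonMult j N * hU

/-- The three-term recurrence of the Hahn polynomials. -/
theorem hahn_three_term {N p j y : ℕ} (hj : j ≤ p) (hN : p + j ≤ N) (hy : y ≤ p) :
    (y : ℝ) * hahn j N p y =
      1 / ((N : ℝ) - 2 * j + 1) *
          (((p : ℝ) - j) * (N - j + 1) * (N - p - j) / (N - 2 * j) +
            (j : ℝ) * (p - j + 1) * (N - p - j + 1) / (N - 2 * j + 2)) * hahn j N p y -
        (if j = 0 then 0 else
          ((p : ℝ) - j + 1) * (N - j + 2) * (N - p - j + 1) /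
            (((N : ℝ) - 2 * j + 2) * (N - 2 * j + 3)) * hahn (j - 1) N p y) -
        ((j : ℝ) + 1) * (p - j) * (N - p - j) / (((N : ℝ) - 2 * j) * (N - 2 * j - 1)) *
          hahn (j + 1) N p y := by
  -- `hahn_up` followed by `hahn_down` expands `(p + 1 - y) H_j`, and `y = (p + 1) - (p + 1 - y)`.
  have hU := hahn_up hj hN (show y ≤ p + 1 by omega)
  have hD1 := hahn_down (show j ≤ p + 1 by omega) hN hy
  have h2j : (2 : ℝ) * j ≤ N := by
    have : 2 * j ≤ N := by omega
    exact_mod_cast this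
  have hN3 : (N : ℝ) + 3 - j * 2 ≠ 0 := by linarith
  have hN2 : (N : ℝ) + 2 - j * 2 ≠ 0 := by linarith
  have hN1 : (N : ℝ) + 1 - j * 2 ≠ 0 := by linarith
  have hN0 : (N : ℝ) + 1 ≠ 0 := by positivity
  have hp : (p : ℝ) + 1 ≠ 0 := by positivity
  rw [show (N : ℝ) - 2 * j + 2 = N + 2 - 2 * j by ring,
    show (N : ℝ) - 2 * j + 3 = N + 3 - 2 * j by ring,
    show (N : ℝ) - 2 * j + 1 = N + 1 - 2 * j by ring]
  have hδ : ((p : ℝ) + 1) * (N - p - j) * (j + 1) / (((N : ℝ) + 1) * (N - 2 * j)) *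
      hahn (j + 1) (N + 1) (p + 1) y = ((j : ℝ) + 1) * (N - p - j) / (N - 2 * j) *
      ((p - j) / (N - 2 * j - 1) * hahn (j + 1) N p y +
        (N - p - j) / (N + 1 - 2 * j) * hahn j N p y) := by
    rcases eq_or_lt_of_le hN with rfl | hN'
    · push_cast; simp
    · have hD2 := hahn_down (show j + 1 ≤ p + 1 by omega) (show p + (j + 1) ≤ N by omega) hy
      rw [if_neg (by omega), Nat.add_sub_cancel] at hD2
      have h0 : (N : ℝ) - j * 2 ≠ 0 := by
        have : 2 * j + 1 ≤ N := by omega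
        have : (2 : ℝ) * j + 1 ≤ N := by exact_mod_cast this
        linarith
      rw [hD2]
      push_cast
      rw [show (N : ℝ) + 1 - 2 * (j + 1) = N - 2 * j - 1 by ring,
        show (N : ℝ) + 3 - 2 * (j + 1) = N + 1 - 2 * j by ring]
      -- For `N = 2 j + 1` the fractions over `N - 2 j - 1` are read as `0` on both sides.
      by_cases h1 : (N : ℝ) - 2 * j - 1 = 0
      · rw [h1]; simp only [zero_mul, div_zero, zero_add]; field_simp; ring
      · field_simp; ring
  rw [hδ, hD1] at hU
  have hrest : (y : ℝ) * hahn j N p y = (p + 1) * hahn j N p y - ((p : ℝ) + 1 - y) * hahn j N p y := by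
    ring
  rw [hrest, hU]
  have hq : ∀ z : ℝ, ((j : ℝ) + 1) * (N - p - j) / (N - 2 * j) * ((p - j) / (N - 2 * j - 1) * z) =
      ((j : ℝ) + 1) * (p - j) * (N - p - j) / (((N : ℝ) - 2 * j) * (N - 2 * j - 1)) * z := by
    intro z
    rw [← mul_assoc, div_mul_div_comm]; ring
  rw [mul_add _ (((p : ℝ) - j) / (N - 2 * j - 1) * hahn (j + 1) N p y), hq]
  have hpred : ∀ z : ℝ, ((p : ℝ) + 1) * (p - j + 1) * (N + 2 - j) / (((N : ℝ) + 1) * (N + 2 - 2 * j)) *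
      (((N : ℝ) - p - j + 1) * (N + 1) / (((p : ℝ) + 1) * (N + 3 - 2 * j)) * z) =
      ((p : ℝ) - j + 1) * (N - j + 2) * (N - p - j + 1) /
            (((N : ℝ) + 2 - 2 * j) * (N + 3 - 2 * j)) * z := by
    intro z; field_simp; ring
  have hif : ((p : ℝ) + 1) * (p - j + 1) * (N + 2 - j) / (((N : ℝ) + 1) * (N + 2 - 2 * j)) *
      (if j = 0 then 0 else ((N : ℝ) - p - j + 1) * (N + 1) / (((p : ℝ) + 1) * (N + 3 - 2 * j)) *
            hahn (j - 1) N p y) = (if j = 0 then 0 else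
          ((p : ℝ) - j + 1) * (N - j + 2) * (N - p - j + 1) /
            (((N : ℝ) + 2 - 2 * j) * (N + 3 - 2 * j)) * hahn (j - 1) N p y) := by
    split_ifs
    · simp
    · exact hpred _
  rw [mul_add (((p : ℝ) + 1) * (p - j + 1) * (N + 2 - j) / (((N : ℝ) + 1) * (N + 2 - 2 * j))), hif]
  have hmid : ((p : ℝ) + 1) - ((p : ℝ) + 1) * (p - j + 1) * (N + 2 - j) /
      (((N : ℝ) + 1) * (N + 2 - 2 * j)) *
      (((p : ℝ) + 1 - j) * (N + 1) / (((N : ℝ) + 1 - 2 * j) * (p + 1))) -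
      ((j : ℝ) + 1) * (N - p - j) / (N - 2 * j) * ((N - p - j) / (N + 1 - 2 * j)) =
      1 / ((N : ℝ) + 1 - 2 * j) *
          (((p : ℝ) - j) * (N - j + 1) * (N - p - j) / (N - 2 * j) +
            (j : ℝ) * (p - j + 1) * (N - p - j + 1) / (N + 2 - 2 * j)) := by
    -- `N = 2 j` forces `p = j`, and the fractions over `N - 2 j` are `0 / 0`.
    by_cases h0 : (N : ℝ) - j * 2 = 0
    · have h3 : p = j := by
        have : (N : ℝ) = ((2 * j : ℕ) : ℝ) := by push_cast; linarith
        have : N = 2 * j := by exact_mod_cast this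
        omega
      subst h3
      have h4 : (N : ℝ) = 2 * p := by linarith
      rw [h4]; ring_nf; field_simp; ring
    · field_simp; ring
  linear_combination (hahn j N p y) * hmid

/-- The sum over all `j` of the Hahn polynomials is supported at `0`. -/
theorem sum_hahn {N p : ℕ} (hp : p ≤ N) {y : ℕ} (hy : y ≤ p) (hy' : y ≤ N - p) :
    ∑ j ∈ range (min p (N - p) + 1), hahn j N p y = if y = 0 then (N.choose p : ℝ) else 0 := by
  split_ifs with h0
  · subst h0
    -- At `y = 0` the values are the multiplicities, whose sum telescopes.
    have : ∀ M, ∑ j ∈ range (M + 1), johnsonMult j N = N.choose M := by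
      intro M
      induction M with
      | zero => simp [johnsonMult]
      | succ M ih => rw [Finset.sum_range_succ, ih]; simp [johnsonMult]
    have h1 : ∀ j, hahn j N p 0 = johnsonMult j N := fun j => by
      simp [hahn_eq, diagCoeff_zero]
    rw [Finset.sum_congr rfl fun j _ => h1 j, this]
    rcases min_choice p (N - p) with h | h <;> rw [h]
    rw [Nat.choose_symm hp]
  -- After `hahn_down`, `H_j(N, p; y)` receives the total weight `(N + 1) / (p + 1)`, independent of
  -- `j`, so vanishing passes from `(N, p)` to `(N + 1, p + 1)`.
  have step : ∀ N p, p ≤ N → y ≤ p → ∑ j ∈ range (min p (N - p) + 1), hahn j N p y = 0 →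
      ∑ j ∈ range (min (p + 1) (N + 1 - (p + 1)) + 1), hahn j (N + 1) (p + 1) y = 0 := by
    intro N p hp hy h
    have e1 : ∑ j ∈ range (min (p + 1) (N + 1 - (p + 1)) + 1), hahn j (N + 1) (p + 1) y =
        ∑ j ∈ range (min (p + 1) (N + 1 - (p + 1)) + 1),
          ((p : ℝ) + 1 - j) * (N + 1) / (((N : ℝ) + 1 - 2 * j) * (p + 1)) * hahn j N p y +
        ∑ j ∈ range (min (p + 1) (N + 1 - (p + 1)) + 1), (if j = 0 then 0 else
          ((N : ℝ) - p - j + 1) * (N + 1) / (((p : ℝ) + 1) * (N + 3 - 2 * j)) *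
            hahn (j - 1) N p y) := by
      rw [← Finset.sum_add_distrib]
      refine Finset.sum_congr rfl fun j hj => ?_
      rw [mem_range] at hj
      exact hahn_down (by omega) (by omega) hy
    -- The possible extra index `j = p + 1` has the coefficient `p + 1 - j = 0`; likewise `j = N -
    -- p` in `e3`.
    have e2 : ∑ j ∈ range (min (p + 1) (N + 1 - (p + 1)) + 1),
          ((p : ℝ) + 1 - j) * (N + 1) / (((N : ℝ) + 1 - 2 * j) * (p + 1)) * hahn j N p y =
        ∑ j ∈ range (min p (N - p) + 1),
          ((p : ℝ) + 1 - j) * (N + 1) / (((N : ℝ) + 1 - 2 * j) * (p + 1)) * hahn j N p y := by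
      symm
      apply Finset.sum_subset
      · intro j; simp only [mem_range]; omega
      · intro j hj hj'
        rw [mem_range] at hj hj'
        have : j = p + 1 := by omega
        subst this
        simp
    have e3 : ∑ j ∈ range (min (p + 1) (N + 1 - (p + 1)) + 1), (if j = 0 then 0 else
          ((N : ℝ) - p - j + 1) * (N + 1) / (((p : ℝ) + 1) * (N + 3 - 2 * j)) *
            hahn (j - 1) N p y) =
        ∑ j ∈ range (min p (N - p) + 1),
          ((N : ℝ) - p - j) * (N + 1) / (((p : ℝ) + 1) * (N + 1 - 2 * j)) * hahn j N p y := by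
      rw [Finset.sum_range_succ']
      simp only [Nat.succ_ne_zero, if_false, if_true, add_zero, Nat.add_sub_cancel]
      have : ∀ j : ℕ, ((N : ℝ) - p - (j + 1 : ℕ) + 1) * (N + 1) /
          (((p : ℝ) + 1) * (N + 3 - 2 * (j + 1 : ℕ))) =
          ((N : ℝ) - p - j) * (N + 1) / (((p : ℝ) + 1) * (N + 1 - 2 * j)) := fun j => by
        push_cast; congr 2 <;> ring
      simp only [this]
      apply Finset.sum_subset
      · intro j; simp only [mem_range]; omega
      · intro j hj hj'
        rw [mem_range] at hj hj'
        have : j = N - p := by omega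
        subst this
        rw [Nat.cast_sub hp]
        simp
    rw [e1, e2, e3, ← Finset.sum_add_distrib]
    calc _ = ∑ j ∈ range (min p (N - p) + 1), ((N : ℝ) + 1) / (p + 1) * hahn j N p y := by
          refine Finset.sum_congr rfl fun j hj => ?_
          rw [mem_range] at hj
          have : (2 : ℝ) * j ≤ N := by
            have : 2 * j ≤ N := by omega
            exact_mod_cast this
          have h1 : (N : ℝ) + 1 - j * 2 ≠ 0 := by linarith
          have h2 : (p : ℝ) + 1 ≠ 0 := by positivity
          field_simp
          ring
      _ = 0 := by rw [← Finset.mul_sum, h, mul_zero]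
  -- Descent on `N`: lower `p` while `y < p`, exchange `p` with `N - p` if `p = y < N - p`, and stop
  -- at `N = 2 y`, `p = y`.
  have main : ∀ M N p, N - y ≤ M → p ≤ N → y ≤ p → y ≤ N - p →
      ∑ j ∈ range (min p (N - p) + 1), hahn j N p y = 0 := by
    intro M
    induction M with
    | zero => intro N p h1 h2 h3 h4; omega
    | succ M ih =>
      intro N p h1 h2 h3 h4
      rcases eq_or_lt_of_le h3 with rfl | h3'
      · rcases eq_or_lt_of_le h4 with h4' | h4'
        · have hN : N = 2 * y := by omega
          subst hN
          rw [show 2 * y - y = y by omega, min_self]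
          have e1 : ∀ j ∈ range (y + 1), hahn j (2 * y) y y = (-1) ^ j * johnsonMult j (2 * y) := by
            intro j hj
            rw [mem_range] at hj
            have : diagCoeff j (y - j) (y - j) y = (-1) ^ j := by
              rw [diagCoeff, Finset.sum_eq_single (j, y - j)]
              · simp
              · intro b hb hb'
                rw [HasAntidiagonal.mem_antidiagonal] at hb
                rcases lt_trichotomy b.1 j with h | h | h
                · simp [Nat.choose_eq_zero_of_lt (show y - j < b.2 by omega)]
                · exact absurd (Prod.ext h (by simp; omega)) hb'
                · simp [Nat.choose_eq_zero_of_lt h]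
              · intro h
                rw [HasAntidiagonal.mem_antidiagonal] at h
                omega
            rw [hahn_eq, show 2 * y - y = y by omega, this]
            simp [mul_comm]
          rw [Finset.sum_congr rfl e1]
          have e2 : ∑ j ∈ range (2 * y + 1), (-1 : ℝ) ^ j * ((2 * y).choose j : ℝ) = 0 := by
            have := Int.alternating_sum_range_choose_of_ne (show 2 * y ≠ 0 by omega)
            exact_mod_cast this
          -- The two binomials of the multiplicity give two partial alternating sums; the reflection
          -- `j ↦ 2 y - j` in `e4` makes them one full, hence zero, alternating sum.
          have e3 : ∑ j ∈ range (y + 1), (-1 : ℝ) ^ j * johnsonMult j (2 * y) =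
              ∑ j ∈ range (y + 1), (-1 : ℝ) ^ j * ((2 * y).choose j : ℝ) +
              ∑ j ∈ range y, (-1 : ℝ) ^ j * ((2 * y).choose j : ℝ) := by
            simp only [johnsonMult, mul_sub, Finset.sum_sub_distrib]
            rw [sub_eq_add_neg, Finset.sum_range_succ' (fun j => (-1 : ℝ) ^ j *
              (if j = 0 then 0 else ((2 * y).choose (j - 1) : ℝ)))]
            congr 1
            simp [pow_succ]
          have e4 : ∑ j ∈ range y, (-1 : ℝ) ^ j * ((2 * y).choose j : ℝ) =
              ∑ j ∈ range y, (-1 : ℝ) ^ (y + 1 + j) * ((2 * y).choose (y + 1 + j) : ℝ) := by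
            rw [← Finset.sum_range_reflect]
            refine Finset.sum_congr rfl fun j hj => ?_
            rw [mem_range] at hj
            rw [← Nat.choose_symm (show y + 1 + j ≤ 2 * y by omega),
              show 2 * y - (y + 1 + j) = y - 1 - j by omega]
            congr 1
            rw [show y + 1 + j = (y - 1 - j) + 2 * (j + 1) by omega, pow_add, pow_mul]
            simp
          rw [e3, e4, ← Finset.sum_range_add, show y + 1 + y = 2 * y + 1 by omega, e2]
        · obtain ⟨N, rfl⟩ : ∃ N', N = N' + 1 := ⟨N - 1, by omega⟩
          have h := step N (N - y) (by omega) (by omega) (by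
            have := ih N y (by omega) (by omega) le_rfl (by omega)
            rw [show N - (N - y) = y by omega, min_comm]
            rw [Finset.sum_congr rfl fun j _ => hahn_symm (show y ≤ N by omega) j y] at this
            exact this)
          rw [show N + 1 - (N - y + 1) = y by omega, min_comm] at h
          rw [Finset.sum_congr rfl fun j _ => hahn_symm h2 j y]
          rw [show N + 1 - y = N - y + 1 by omega]
          exact h
      · obtain ⟨p, rfl⟩ : ∃ p', p = p' + 1 := ⟨p - 1, by omega⟩
        obtain ⟨N, rfl⟩ : ∃ N', N = N' + 1 := ⟨N - 1, by omega⟩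
        exact step N p (by omega) (by omega) (ih N p (by omega) (by omega) (by omega) (by omega))
  exact main _ N p le_rfl hp hy hy'

/-- The difference equation of the dual Hahn polynomials, for the Johnson scheme. -/
theorem hahn_difference {N p j y : ℕ} (hj : j ≤ p) (hN : p + j ≤ N) (hy : y ≤ p)
    (hy' : y ≤ N - p) :
    (y : ℝ) ^ 2 * hahn j N p (y - 1) +
        ((y : ℝ) * (p - y) + (y : ℝ) * (N - p - y)) * hahn j N p y +
        ((p : ℝ) - y) * (N - p - y) * hahn j N p (y + 1) =
      ((p : ℝ) * (N - p) - j * (N + 1 - j)) * hahn j N p y := by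
  have hpN : p ≤ N := by omega
  have ca : ((p - j : ℕ) : ℝ) = p - j := by rw [Nat.cast_sub hj]
  have cb : ((N - p - j : ℕ) : ℝ) = N - p - j := by
    rw [Nat.cast_sub (by omega), Nat.cast_sub hpN]
  have hpos : ∀ z, z ≤ p → z ≤ N - p → (p.choose z : ℝ) ≠ 0 ∧ ((N - p).choose z : ℝ) ≠ 0 :=
    fun z h1 h2 => ⟨by exact_mod_cast (Nat.choose_pos h1).ne',
      by exact_mod_cast (Nat.choose_pos h2).ne'⟩
  obtain ⟨v1, v2⟩ := hpos y hy hy'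
  -- The coefficient vanishes at `y = p` and at `y = N - p`, so the conventional value of `H_j`
  -- beyond its range plays no role.
  have hup : ((p : ℝ) - y) * (N - p - y) * hahn j N p (y + 1) = ((y : ℝ) + 1) ^ 2 *
      johnsonMult j N / ((p.choose y : ℝ) * ((N - p).choose y : ℝ)) *
      diagCoeff j (p - j) (N - p - j) (y + 1) := by
    rcases eq_or_lt_of_le hy with rfl | h1
    · rw [diagCoeff_eq_zero (by omega)]; simp
    rcases eq_or_lt_of_le hy' with rfl | h2
    · rw [diagCoeff_swap, diagCoeff_eq_zero (by omega), Nat.cast_sub hpN]; simp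
    obtain ⟨w1, w2⟩ := hpos (y + 1) h1 h2
    have h3 := succ_mul_choose_succ p y
    have h4 := succ_mul_choose_succ (N - p) y
    rw [Nat.cast_sub hpN] at h4
    rw [hahn_eq]
    field_simp
    linear_combination (-johnsonMult j N * diagCoeff j (p - j) (N - p - j) (y + 1)) * (((N : ℝ) - p - y) *
      ((N - p).choose y : ℝ) * h3 + ((y : ℝ) + 1) * (p.choose (y + 1) : ℝ) * h4)
  rw [hup]
  rcases y with _ | y
  · rw [hahn_eq, diagCoeff_zero, diagCoeff_one, ca, cb]
    push_cast
    field_simp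
    ring
  · have hdiff := diagCoeff_difference j (p - j) (N - p - j) y
    rw [ca, cb] at hdiff
    obtain ⟨w1, w2⟩ := hpos y (by omega) (by omega)
    have h3 := succ_mul_choose_succ p y
    have h4 := succ_mul_choose_succ (N - p) y
    rw [Nat.cast_sub hpN] at h4
    have hdown : ((y + 1 : ℕ) : ℝ) ^ 2 * hahn j N p y = ((p : ℝ) - y) * (N - p - y) *
        johnsonMult j N / ((p.choose (y + 1) : ℝ) * ((N - p).choose (y + 1) : ℝ)) *
        diagCoeff j (p - j) (N - p - j) y := by
      rw [hahn_eq]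
      push_cast
      field_simp
      linear_combination (johnsonMult j N * diagCoeff j (p - j) (N - p - j) y) * (((N : ℝ) - p - y) *
        ((N - p).choose y : ℝ) * h3 + ((y : ℝ) + 1) * (p.choose (y + 1) : ℝ) * h4)
    rw [Nat.add_sub_cancel, hdown, hahn_eq]
    push_cast
    field_simp
    linear_combination johnsonMult j N * hdiff

/-! ### The Johnson graph on the `k`-sets containing a fixed set -/

theorem sum_eq_card_mul {ι : Type*} {s : Finset ι} {f : ι → ℝ} {c : ℝ} (h : ∀ x ∈ s, f x = c) :
    ∑ x ∈ s, f x = #s * c := by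
  rw [Finset.sum_eq_card_nsmul h, nsmul_eq_mul]

theorem card_swap_sdiff {α : Type*} [DecidableEq α] {T Z : Finset α} {x t : α} (hx : x ∈ T) (ht : t ∉ T) :
    #((insert t (T.erase x)) \ Z) =
      #(T \ Z) - (if x ∈ Z then 0 else 1) + (if t ∈ Z then 0 else 1) := by
  have h1 : #((T.erase x) \ Z) = #(T \ Z) - (if x ∈ Z then 0 else 1) := by
    rw [erase_sdiff_comm]
    split_ifs with h
    · rw [erase_eq_of_notMem (by simp [h]), Nat.sub_zero]
    · rw [card_erase_of_mem (by simp [h, hx])]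
  split_ifs at h1 ⊢ with h2 h3 h3
  all_goals first
    | rw [insert_sdiff_of_mem _ ‹t ∈ Z›, h1, add_zero]
    | rw [insert_sdiff_of_notMem _ ‹t ∉ Z›, card_insert_of_notMem (by simp [ht]), h1]

section Johnson

variable {α : Type*} [Fintype α] [DecidableEq α]

/-- The `k`-subsets containing `U`. -/
def supersets (U : Finset α) (k : ℕ) : Finset (Finset α) :=
  univ.filter fun T => U ⊆ T ∧ #T = k

theorem mem_supersets {U T : Finset α} {k : ℕ} : T ∈ supersets U k ↔ U ⊆ T ∧ #T = k := by
  simp [supersets]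

/-- A neighbour `T'` determines its swap, by `T \ T' = {x}` and `T' \ T = {t}`. -/
theorem sum_neighbors {U T : Finset α} {k : ℕ} (hT : T ∈ supersets U k) (F : Finset α → ℝ) :
    ∑ T' ∈ supersets U k with #(T \ T') = 1, F T' =
      ∑ x ∈ T \ U, ∑ t ∈ Tᶜ, F (insert t (T.erase x)) := by
  rw [mem_supersets] at hT
  obtain ⟨hUT, hk⟩ := hT
  rw [← Finset.sum_product']
  symm
  refine Finset.sum_bij (fun a _ => insert a.2 (T.erase a.1)) ?_ ?_ ?_ ?_
  · rintro ⟨x, t⟩ h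
    simp only [mem_product, mem_sdiff, mem_compl] at h
    obtain ⟨⟨hx, hxU⟩, ht⟩ := h
    rw [mem_filter, mem_supersets]
    have hxt : x ≠ t := fun h => ht (h ▸ hx)
    refine ⟨⟨?_, ?_⟩, ?_⟩
    · intro u hu
      rw [mem_insert, mem_erase]
      exact Or.inr ⟨by rintro rfl; exact hxU hu, hUT hu⟩
    · rw [card_insert_of_notMem (fun h => ht (mem_of_mem_erase h)), card_erase_of_mem hx, ← hk]
      have : 0 < #T := card_pos.2 ⟨x, hx⟩
      omega
    · rw [card_eq_one]
      refine ⟨x, ?_⟩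
      ext u
      simp only [mem_sdiff, mem_insert, mem_erase, mem_singleton, not_or, not_and]
      constructor
      · rintro ⟨h1, h2, h3⟩
        by_contra h
        exact h3 h h1
      · rintro rfl
        exact ⟨hx, hxt, fun h => absurd rfl h⟩
  · rintro ⟨x, t⟩ h ⟨x', t'⟩ h' he
    simp only [mem_product, mem_sdiff, mem_compl] at h h'
    have e : ∀ u, u ∈ insert t (T.erase x) ↔ u ∈ insert t' (T.erase x') := by
      intro u; exact he ▸ Iff.rfl
    simp only [mem_insert, mem_erase] at e
    have h1 := e x
    have h2 := e t
    have hxt : x ≠ t := fun hh => h.2 (hh ▸ h.1.1)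
    have hxt' : x ≠ t' := fun hh => h'.2 (hh ▸ h.1.1)
    simp only [Prod.mk.injEq]
    tauto
  · intro T' hT'
    rw [mem_filter, mem_supersets] at hT'
    obtain ⟨⟨hU', hk'⟩, h1⟩ := hT'
    have h2 : #(T' \ T) = 1 := by rw [Finset.card_sdiff_comm (hk'.trans hk.symm), h1]
    rw [card_eq_one] at h1 h2
    obtain ⟨x, hx⟩ := h1
    obtain ⟨t, ht⟩ := h2
    have ex : ∀ u, u ∈ T \ T' ↔ u = x := fun u => by rw [hx, mem_singleton]
    have et : ∀ u, u ∈ T' \ T ↔ u = t := fun u => by rw [ht, mem_singleton]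
    simp only [mem_sdiff] at ex et
    have ex' := (ex x).2 rfl
    have et' := (et t).2 rfl
    refine ⟨(x, t), ?_, ?_⟩
    · simp only [mem_product, mem_sdiff, mem_compl]
      exact ⟨⟨ex'.1, fun h => ex'.2 (hU' h)⟩, et'.2⟩
    · ext u
      simp only [mem_insert, mem_erase]
      have h3 := ex u
      have h4 := et u
      by_cases hux : u = x
      · subst hux; tauto
      · tauto
  · intro a _; rfl

/-- Removing `U` gives the Johnson graph on `k - #U` points out of `#α - #U`. Sorting the swaps by
whether `x` and `t` lie in `Z` turns the sum into the left side of `hahn_difference`. -/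
theorem sum_neighbors_eigen {U T Z : Finset α} {k j : ℕ} (hT : T ∈ supersets U k)
    (hZ : Z ∈ supersets U k) (hj : #U + j ≤ k) (hjn : k + j ≤ Fintype.card α) :
    ∑ T' ∈ supersets U k with #(T \ T') = 1,
        hahn j (Fintype.card α - #U) (k - #U) #(T' \ Z) =
      ((k - #U : ℕ) * ((Fintype.card α - #U : ℕ) - (k - #U : ℕ) : ℝ) -
        j * ((Fintype.card α - #U : ℕ) + 1 - j : ℝ)) *
        hahn j (Fintype.card α - #U) (k - #U) #(T \ Z) := by
  rw [sum_neighbors hT]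
  rw [mem_supersets] at hT hZ
  set f := hahn j (Fintype.card α - #U) (k - #U) with hf
  set d := #(T \ Z) with hd
  have hUk : #U ≤ k := by omega
  have c1 : #((T \ U).filter (· ∉ Z)) = d := by
    rw [hd]; congr 1; ext u
    have := @hZ.1 u
    simp only [mem_filter, mem_sdiff]; tauto
  have c2 : #((T \ U).filter (· ∈ Z)) + d = k - #U := by
    rw [← c1, card_filter_add_card_filter_not, card_sdiff_of_subset hT.1, hT.2]
  have c3 : #(Tᶜ.filter (· ∈ Z)) = d := by
    rw [hd, Finset.card_sdiff_comm (hT.2.trans hZ.2.symm)]; congr 1; ext u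
    simp only [mem_filter, mem_sdiff, mem_compl]; tauto
  have c4 : #(Tᶜ.filter (· ∉ Z)) + d = Fintype.card α - k := by
    rw [← c3, add_comm, card_filter_add_card_filter_not, card_compl, hT.2]
  have hD := hahn_difference (N := Fintype.card α - #U) (p := k - #U) (j := j) (y := d)
    (by omega) (by omega) (by omega) (by omega)
  rw [← hf] at hD
  rw [← hD]
  have inner : ∀ e : ℕ, ∑ t ∈ Tᶜ, f (e + if t ∈ Z then 0 else 1) =
      d * f e + ((Fintype.card α - #U : ℕ) - (k - #U : ℕ) - d : ℝ) * f (e + 1) := by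
    intro e
    rw [← Finset.sum_filter_add_sum_filter_not _ (· ∈ Z)]
    have c4' : (#(Tᶜ.filter (· ∉ Z)) : ℝ) =
        ((Fintype.card α - #U : ℕ) - (k - #U : ℕ) - d : ℝ) := by
      have h : #(Tᶜ.filter (· ∉ Z)) + d + (k - #U) = Fintype.card α - #U := by omega
      have h' : (#(Tᶜ.filter (· ∉ Z)) : ℝ) + d + (k - #U : ℕ) = (Fintype.card α - #U : ℕ) := by
        exact_mod_cast h
      linarith
    rw [← c4', sum_eq_card_mul (c := f e), sum_eq_card_mul (c := f (e + 1)), c3]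
    · intro t ht
      rw [if_neg (mem_filter.1 ht).2]
    · intro t ht
      rw [if_pos (mem_filter.1 ht).2, add_zero]
  calc _ = ∑ x ∈ T \ U, ∑ t ∈ Tᶜ, f (d - (if x ∈ Z then 0 else 1) + if t ∈ Z then 0 else 1) := by
        refine Finset.sum_congr rfl fun x hx => Finset.sum_congr rfl fun t ht => ?_
        rw [card_swap_sdiff (mem_sdiff.1 hx).1 (mem_compl.1 ht)]
    _ = (#((T \ U).filter (· ∈ Z)) : ℝ) * (d * f d +
          ((Fintype.card α - #U : ℕ) - (k - #U : ℕ) - d : ℝ) * f (d + 1)) +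
        d * (d * f (d - 1) +
          ((Fintype.card α - #U : ℕ) - (k - #U : ℕ) - d : ℝ) * f (d - 1 + 1)) := by
        rw [← Finset.sum_filter_add_sum_filter_not _ (· ∈ Z),
          sum_eq_card_mul (s := (T \ U).filter (· ∈ Z)) (c := d * f d +
            ((Fintype.card α - #U : ℕ) - (k - #U : ℕ) - d : ℝ) * f (d + 1)),
          sum_eq_card_mul (s := (T \ U).filter (· ∉ Z)) (c := d * f (d - 1) +
            ((Fintype.card α - #U : ℕ) - (k - #U : ℕ) - d : ℝ) * f (d - 1 + 1)), c1]
        · intro t ht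
          rw [if_neg (mem_filter.1 ht).2, inner]
        · intro t ht
          rw [if_pos (mem_filter.1 ht).2, Nat.sub_zero, inner]
    _ = _ := by
        have c2' : (#((T \ U).filter (· ∈ Z)) : ℝ) = (k - #U : ℕ) - d := by
          have : (#((T \ U).filter (· ∈ Z)) : ℝ) + d = (k - #U : ℕ) := by exact_mod_cast c2
          linarith
        rw [c2']
        -- The truncated `d - 1` at `d = 0` only occurs with the coefficient `d`.
        rcases Nat.eq_zero_or_pos d with h0 | h0
        · rw [h0]; push_cast; ring
        · rw [Nat.sub_add_cancel h0]; ring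

/-- Orthogonality of the idempotents of the Johnson scheme on the `k`-subsets containing `U`. -/
theorem sum_hahn_mul_hahn {U X Z : Finset α} {k j j' : ℕ} (hX : X ∈ supersets U k)
    (hZ : Z ∈ supersets U k) (hj : #U + j ≤ k) (hjn : k + j ≤ Fintype.card α)
    (hj' : #U + j' ≤ k) (hjn' : k + j' ≤ Fintype.card α) :
    ∑ T ∈ supersets U k, hahn j (Fintype.card α - #U) (k - #U) #(T \ X) *
        hahn j' (Fintype.card α - #U) (k - #U) #(T \ Z) =
      if j = j' then ((Fintype.card α - #U).choose (k - #U) : ℝ) *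
        hahn j (Fintype.card α - #U) (k - #U) #(X \ Z) else 0 := by
  set N := Fintype.card α - #U with hN
  set p := k - #U with hp
  -- Adjacency is symmetric, so the eigenvalues of both factors multiply the sum to the same result.
  have orth : ∀ j j', #U + j ≤ k → k + j ≤ Fintype.card α → #U + j' ≤ k →
      k + j' ≤ Fintype.card α → j ≠ j' →
      ∑ T ∈ supersets U k, hahn j N p #(T \ X) * hahn j' N p #(T \ Z) = 0 := by
    intro j j' hj hjn hj' hjn' hne
    have e : ((p : ℝ) * (N - p) - j * (N + 1 - j)) *
        ∑ T ∈ supersets U k, hahn j N p #(T \ X) * hahn j' N p #(T \ Z) =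
        ((p : ℝ) * (N - p) - j' * (N + 1 - j')) *
        ∑ T ∈ supersets U k, hahn j N p #(T \ X) * hahn j' N p #(T \ Z) := by
      calc _ = ∑ T ∈ supersets U k, ∑ T' ∈ supersets U k with #(T \ T') = 1,
            hahn j N p #(T' \ X) * hahn j' N p #(T \ Z) := by
            rw [Finset.mul_sum]
            refine Finset.sum_congr rfl fun T hT => ?_
            rw [← Finset.sum_mul, sum_neighbors_eigen hT hX hj hjn]
            ring
        _ = ∑ T' ∈ supersets U k, ∑ T ∈ supersets U k with #(T' \ T) = 1,
            hahn j N p #(T' \ X) * hahn j' N p #(T \ Z) := by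
            refine Finset.sum_comm' fun T T' => ?_
            rw [mem_filter, mem_filter]
            constructor
            · rintro ⟨h1, h2, h3⟩
              refine ⟨⟨h1, ?_⟩, h2⟩
              rw [Finset.card_sdiff_comm, h3]
              rw [(mem_supersets.1 h1).2, (mem_supersets.1 h2).2]
            · rintro ⟨⟨h1, h3⟩, h2⟩
              refine ⟨h1, h2, ?_⟩
              rw [Finset.card_sdiff_comm, h3]
              rw [(mem_supersets.1 h1).2, (mem_supersets.1 h2).2]
        _ = _ := by
            rw [Finset.mul_sum]
            refine Finset.sum_congr rfl fun T hT => ?_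
            rw [← Finset.mul_sum, sum_neighbors_eigen hT hZ hj' hjn']
            ring
    by_contra hS
    have h1 := mul_right_cancel₀ hS e
    -- The second factor is positive because `j ≤ p` and `j' ≤ N - p`; hence the eigenvalues are
    -- distinct.
    have h2 : ((j : ℝ) - j') * ((N : ℝ) + 1 - j - j') = 0 := by linear_combination -h1
    rcases mul_eq_zero.1 h2 with h | h
    · exact hne (by exact_mod_cast sub_eq_zero.1 h)
    · have h3 : j + j' ≤ N := by omega
      have h4 : (j : ℝ) + j' ≤ N := by exact_mod_cast h3
      linarith
  split_ifs with hjj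
  · subst hjj
    have hXs := mem_supersets.1 hX
    have hZs := mem_supersets.1 hZ
    -- Adding the orthogonal terms `l ≠ j` completes the second factor to the sum of all `H_l`,
    -- which is supported at `T = Z`.
    have e1 : ∑ T ∈ supersets U k, hahn j N p #(T \ X) *
        (∑ l ∈ range (min p (N - p) + 1), hahn l N p #(T \ Z)) =
        ∑ T ∈ supersets U k, hahn j N p #(T \ X) * hahn j N p #(T \ Z) := by
      simp only [Finset.mul_sum]
      rw [Finset.sum_comm, Finset.sum_eq_single j]
      · intro l hl hlj
        rw [mem_range] at hl
        exact orth j l hj hjn (by omega) (by omega) (Ne.symm hlj)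
      · intro h
        rw [mem_range] at h
        omega
    rw [← e1, Finset.sum_eq_single Z]
    · rw [sum_hahn (by omega) (by simp) (by simp)]
      rw [if_pos (by simp), Finset.card_sdiff_comm (hXs.2.trans hZs.2.symm), mul_comm]
    · intro T hT hTZ
      rw [mem_supersets] at hT
      have h1 : #(T \ Z) ≤ p := by
        rw [hp, ← hT.2, ← card_sdiff_of_subset hT.1]
        exact card_le_card (sdiff_subset_sdiff le_rfl hZs.1)
      have h2 : #(T \ Z) ≤ N - p := by
        have : #(T \ Z) ≤ #Zᶜ := card_le_card fun u hu => by
          rw [mem_compl]; exact (mem_sdiff.1 hu).2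
        rw [card_compl, hZs.2] at this
        omega
      rw [sum_hahn (by omega) h1 h2, if_neg, mul_zero]
      intro h
      rw [card_eq_zero, sdiff_eq_empty_iff_subset] at h
      exact hTZ (eq_of_subset_of_card_le h (by rw [hZs.2, hT.2]))
    · intro h
      exact absurd hZ h
  · exact orth j j' hj hjn hj' hjn' hjj

end Johnson

/-! ### Krawtchouk factors as products of kernels on the symbols -/

theorem coeff_one_add_C_mul_X_pow (a : ℝ) (m u : ℕ) :
    ((1 + Polynomial.C a * Polynomial.X) ^ m : Polynomial ℝ).coeff u =
      a ^ u * (m.choose u : ℝ) := by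
  have : ((1 + Polynomial.C a * Polynomial.X) ^ m : Polynomial ℝ) =
      ((1 + Polynomial.X) ^ m : Polynomial ℝ).comp (Polynomial.C a * Polynomial.X) := by simp
  rw [this, Polynomial.comp_C_mul_X_coeff, Polynomial.coeff_one_add_X_pow, mul_comm]

/-- The Krawtchouk polynomial as an elementary symmetric function of `-1` and `q - 1`. -/
theorem sum_powersetCard_prod_eq_krawtchouk {α : Type*} [DecidableEq α] (I : Finset α)
    (P : α → Prop) [DecidablePred P] (i q : ℕ) :
    ∑ U ∈ I.powersetCard i, ∏ l ∈ U, (if P l then (-1 : ℝ) else (q : ℝ) - 1) =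
      krawtchouk i #I q #(I.filter P) := by
  set w : α → ℝ := fun l => if P l then (-1 : ℝ) else (q : ℝ) - 1 with hw
  -- Both sides of the theorem are the coefficient of `z^i` in `∏ (1 + w_l z)`.
  have h1 : (∏ l ∈ I, (1 + Polynomial.C (w l) * Polynomial.X)).coeff i =
      ∑ U ∈ I.powersetCard i, ∏ l ∈ U, w l := by
    rw [Finset.prod_one_add, Polynomial.finsetSum_coeff, Finset.powersetCard_eq_filter,
      Finset.sum_filter]
    refine Finset.sum_congr rfl fun U _ => ?_
    rw [Finset.prod_mul_distrib, Finset.prod_const, ← map_prod, Polynomial.coeff_C_mul,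
      Polynomial.coeff_X_pow]
    by_cases h : #U = i
    · simp [h]
    · simp [h, Ne.symm h]
  have h2 : ∏ l ∈ I, (1 + Polynomial.C (w l) * Polynomial.X) =
      (1 + Polynomial.C (-1) * Polynomial.X) ^ #(I.filter P) *
        (1 + Polynomial.C ((q : ℝ) - 1) * Polynomial.X) ^ (#I - #(I.filter P)) := by
    have h3 : #I - #(I.filter P) = #(I.filter fun l => ¬ P l) := by
      rw [← card_filter_add_card_filter_not (s := I) P]; omega
    rw [h3, ← Finset.prod_filter_mul_prod_filter_not I P]
    congr 1
    · rw [← Finset.prod_const]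
      refine Finset.prod_congr rfl fun l hl => ?_
      simp only [hw, if_pos (mem_filter.1 hl).2]
    · rw [← Finset.prod_const]
      refine Finset.prod_congr rfl fun l hl => ?_
      simp only [hw, if_neg (mem_filter.1 hl).2]
  rw [← h1, h2, Polynomial.coeff_mul, krawtchouk_eq_sum_antidiagonal]
  refine Finset.sum_congr rfl fun p _ => ?_
  rw [coeff_one_add_C_mul_X_pow, coeff_one_add_C_mul_X_pow]

section Vertex

variable {r n : ℕ}

/-- The support of a vector. -/
def support (x : Fin n → Fin r) : Finset (Fin n) := univ.filter fun l => (x l).val ≠ 0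

theorem mem_support {x : Fin n → Fin r} {l : Fin n} : l ∈ support x ↔ (x l).val ≠ 0 := by
  simp [support]

/-- The kernel `(r - 1) [a = b] - 1` on the nonzero symbols. -/
def symbolKernel (a b : Fin r) : ℝ := (if a = b then ((r - 1 : ℕ) : ℝ) else 0) - 1

theorem card_filter_val_ne_zero (hr : 0 < r) : #(univ.filter fun v : Fin r => v.val ≠ 0) = r - 1 := by
  obtain ⟨r, rfl⟩ : ∃ r', r = r' + 1 := ⟨r - 1, by omega⟩
  have : (univ.filter fun v : Fin (r + 1) => v.val ≠ 0) = univ.erase 0 := by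
    ext v; simp only [mem_filter, mem_univ, true_and, mem_erase, and_true, ne_eq, Fin.ext_iff, Fin.val_zero]
  rw [this, card_erase_of_mem (mem_univ _)]
  simp

theorem card_filter_val_eq_zero (hr : 0 < r) : #(univ.filter fun v : Fin r => v.val = 0) = 1 := by
  rw [card_eq_one]
  exact ⟨⟨0, hr⟩, by ext v; simp [Fin.ext_iff]⟩

theorem symbolKernel_comm (a b : Fin r) : symbolKernel a b = symbolKernel b a := by
  by_cases h : a = b
  · rw [h]
  · simp [symbolKernel, h, Ne.symm h]

/-- The kernel annihilates constants on the nonzero symbols; with `sum_symbolKernel_mul` it is `r -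
1` times a projection. -/
theorem sum_symbolKernel (hr : 0 < r) {a : Fin r} (ha : a.val ≠ 0) :
    ∑ v : Fin r with v.val ≠ 0, symbolKernel a v = 0 := by
  simp only [symbolKernel]
  rw [Finset.sum_sub_distrib, Finset.sum_ite_eq, if_pos (by simp [ha]), Finset.sum_const,
    card_filter_val_ne_zero hr]
  simp

theorem sum_symbolKernel_mul (hr : 0 < r) {a c : Fin r} (ha : a.val ≠ 0) (hc : c.val ≠ 0) :
    ∑ v : Fin r with v.val ≠ 0, symbolKernel a v * symbolKernel v c =
      ((r - 1 : ℕ) : ℝ) * symbolKernel a c := by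
  have h1 : ∀ v : Fin r, symbolKernel a v * symbolKernel v c =
      (if a = v then ((r - 1 : ℕ) : ℝ) * symbolKernel v c else 0) - symbolKernel c v := by
    intro v
    rw [symbolKernel_comm c v]
    by_cases h : a = v <;> (simp [h, symbolKernel]; try ring)
  simp only [h1]
  rw [Finset.sum_sub_distrib, sum_symbolKernel hr hc, Finset.sum_ite_eq, if_pos (by simp [ha]),
    sub_zero]

theorem filter_support_eq (T : Finset (Fin n)) :
    (univ.filter fun y : Fin n → Fin r => support y = T) =
      Fintype.piFinset fun l => if l ∈ T then univ.filter (fun v : Fin r => v.val ≠ 0)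
        else univ.filter fun v : Fin r => v.val = 0 := by
  ext y
  rw [mem_filter, Fintype.mem_piFinset]
  simp only [mem_univ, true_and, Finset.ext_iff, mem_support]
  refine forall_congr' fun l => ?_
  by_cases h : l ∈ T <;> simp [h]

/-- The sum factors over the coordinates. One in both `U` and `U'` gives `r - 1` times the kernel,
one in `T` alone `r - 1`, one outside `T` a single choice, and one in exactly one of `U`, `U'` gives
zero. -/
theorem sum_prod_symbolKernel (hr : 0 < r) {x z : Fin n → Fin r} {T U U' : Finset (Fin n)}
    (hU : U ⊆ support x) (hUT : U ⊆ T) (hU' : U' ⊆ support z) (hUT' : U' ⊆ T) :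
    ∑ y : Fin n → Fin r with support y = T, (∏ l ∈ U, symbolKernel (x l) (y l)) *
        ∏ l ∈ U', symbolKernel (y l) (z l) =
      if U = U' then ((r - 1 : ℕ) : ℝ) ^ #T * ∏ l ∈ U, symbolKernel (x l) (z l) else 0 := by
  have h1 : ∀ y : Fin n → Fin r, (∏ l ∈ U, symbolKernel (x l) (y l)) *
        ∏ l ∈ U', symbolKernel (y l) (z l) =
      ∏ l, ((if l ∈ U then symbolKernel (x l) (y l) else 1) *
        if l ∈ U' then symbolKernel (y l) (z l) else 1) := by
    intro y
    rw [Finset.prod_mul_distrib, Finset.prod_ite_mem, Finset.prod_ite_mem, univ_inter, univ_inter]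
  simp only [h1]
  rw [filter_support_eq, ← Finset.prod_univ_sum (fun l => if l ∈ T then
    univ.filter (fun v : Fin r => v.val ≠ 0) else univ.filter fun v : Fin r => v.val = 0)
    (fun l v => (if l ∈ U then symbolKernel (x l) v else 1) *
        if l ∈ U' then symbolKernel v (z l) else 1)]
  split_ifs with h
  · subst h
    calc _ = ∏ l, ((if l ∈ T then ((r - 1 : ℕ) : ℝ) else 1) *
          if l ∈ U then symbolKernel (x l) (z l) else 1) := by
          refine Finset.prod_congr rfl fun l _ => ?_
          by_cases hT : l ∈ T
          · by_cases hl : l ∈ U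
            · simp only [hT, hl, if_true]
              exact sum_symbolKernel_mul hr (mem_support.1 (hU hl)) (mem_support.1 (hU' hl))
            · simp [hT, hl, card_filter_val_ne_zero hr]
          · have hl : l ∉ U := fun h => hT (hUT h)
            simp only [hT, hl, if_false, mul_one, Finset.sum_const, card_filter_val_eq_zero hr,
              one_smul]
      _ = _ := by
          rw [Finset.prod_mul_distrib, Finset.prod_ite_mem, Finset.prod_ite_mem, univ_inter,
            univ_inter, Finset.prod_const]
  · obtain ⟨l, hl⟩ : ∃ l, ¬ (l ∈ U ↔ l ∈ U') := by
      by_contra hh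
      push Not at hh
      exact h (Finset.ext hh)
    refine Finset.prod_eq_zero (mem_univ l) ?_
    by_cases hlU : l ∈ U
    · have hlU' : l ∉ U' := fun h => hl ⟨fun _ => h, fun _ => hlU⟩
      simp only [hUT hlU, hlU, hlU', if_true, if_false, mul_one]
      exact sum_symbolKernel hr (mem_support.1 (hU hlU))
    · have hlU' : l ∈ U' := by tauto
      simp only [hUT' hlU', hlU, hlU', if_true, if_false, one_mul]
      simp only [symbolKernel_comm _ (z l)]
      exact sum_symbolKernel hr (mem_support.1 (hU' hlU'))

end Vertex

/-! ### Orthogonality relations of the second eigenmatrix -/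

section Eigenmatrix

variable {r n k : ℕ}

theorem card_support (x : Vertex r n k) : #(support x.1) = k := x.2

theorem commonNonzero_eq (x y : Fin n → Fin r) :
    commonNonzero x y = #(support x ∩ support y) := by
  rw [commonNonzero, support, support, ← Finset.filter_and]

/-- In this form the dependence on the symbols is a sum of coordinatewise products, and the rest
depends on the supports alone. -/
theorem secondEigenmatrix_relation (x y : Vertex r n k) (a : ℕ × ℕ) :
    secondEigenmatrix r n k a (relation r n k x y) =
      (n.choose a.1 : ℝ) / (k.choose a.1 : ℝ) *
        (∑ U ∈ (support x.1 ∩ support y.1).powersetCard a.1,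
          ∏ l ∈ U, symbolKernel (x.1 l) (y.1 l)) *
        hahn a.2 (n - a.1) (k - a.1) #(support x.1 \ support y.1) := by
  have h1 : k - commonNonzero x.1 y.1 = #(support x.1 \ support y.1) := by
    rw [commonNonzero_eq, card_sdiff, card_support x, inter_comm]
  have h2 : k - (k - commonNonzero x.1 y.1) = #(support x.1 ∩ support y.1) := by
    have := commonNonzero_le x.1 y.1
    rw [x.2] at this
    rw [← commonNonzero_eq]
    omega
  have h3 : commonNonzero x.1 y.1 - equalNonzero x.1 y.1 =
      #((support x.1 ∩ support y.1).filter fun l => x.1 l ≠ y.1 l) := by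
    have := card_filter_add_card_filter_not (s := support x.1 ∩ support y.1)
      (fun l => x.1 l = y.1 l)
    have h4 : equalNonzero x.1 y.1 =
        #((support x.1 ∩ support y.1).filter fun l => x.1 l = y.1 l) := by
      rw [equalNonzero]
      congr 1
      ext l
      simp only [mem_filter, mem_univ, true_and, mem_inter, mem_support]
      constructor
      · rintro ⟨h, h'⟩
        exact ⟨⟨h ▸ h', h'⟩, h⟩
      · rintro ⟨⟨_, h'⟩, h⟩
        exact ⟨h, h'⟩
    rw [commonNonzero_eq, h4]
    simp only [ne_eq]
    omega
  have h5 : ∑ U ∈ (support x.1 ∩ support y.1).powersetCard a.1,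
      ∏ l ∈ U, symbolKernel (x.1 l) (y.1 l) =
      krawtchouk a.1 #(support x.1 ∩ support y.1) (r - 1)
        #((support x.1 ∩ support y.1).filter fun l => x.1 l ≠ y.1 l) := by
    rw [← sum_powersetCard_prod_eq_krawtchouk]
    refine Finset.sum_congr rfl fun U _ => Finset.prod_congr rfl fun l _ => ?_
    by_cases h : x.1 l = y.1 l <;> simp [symbolKernel, h]
  rw [h5]
  simp only [secondEigenmatrix, relation]
  rw [h2, h3, h1]

theorem sum_vertex (F : (Fin n → Fin r) → ℝ) :
    ∑ y : Vertex r n k, F y.1 =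
      ∑ T ∈ (univ : Finset (Fin n)).powersetCard k, ∑ y : Fin n → Fin r with support y = T, F y := by
  have h1 : ∑ y : Vertex r n k, F y.1 = ∑ y : Fin n → Fin r with weight y = k, F y :=
    (Finset.sum_subtype (p := fun y => weight y = k) _ (by simp) F).symm
  rw [h1, ← Finset.sum_fiberwise_of_maps_to (g := support)
    (t := (univ : Finset (Fin n)).powersetCard k)]
  · refine Finset.sum_congr rfl fun T hT => ?_
    rw [mem_powersetCard] at hT
    refine Finset.sum_congr ?_ fun _ _ => rfl
    ext y
    simp only [mem_filter, mem_univ, true_and, and_iff_right_iff_imp]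
    rintro rfl
    exact hT.2
  · intro y hy
    rw [mem_powersetCard]
    exact ⟨subset_univ _, (mem_filter.1 hy).2⟩

theorem card_vertex (hr : 0 < r) :
    (Fintype.card (Vertex r n k) : ℝ) = (n.choose k : ℝ) * ((r - 1 : ℕ) : ℝ) ^ k := by
  have h1 := sum_vertex (r := r) (n := n) (k := k) fun _ => 1
  rw [Finset.sum_const, nsmul_eq_mul, mul_one, Finset.card_univ] at h1
  rw [h1]
  have h2 : ∀ T ∈ (univ : Finset (Fin n)).powersetCard k,
      ∑ y : Fin n → Fin r with support y = T, (1 : ℝ) = ((r - 1 : ℕ) : ℝ) ^ k := by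
    intro T hT
    -- With empty products this counts the vectors of support `T`.
    have := sum_prod_symbolKernel hr (x := fun _ => ⟨0, hr⟩) (z := fun _ => ⟨0, hr⟩) (T := T)
      (empty_subset _) (empty_subset _) (empty_subset _) (empty_subset _)
    rw [mem_powersetCard] at hT
    simpa [hT.2] using this
  rw [Finset.sum_congr rfl h2, Finset.sum_const, card_powersetCard, Finset.card_univ,
    Fintype.card_fin, nsmul_eq_mul]

/-- The matrices `|S| E_a` multiply as `|S|` times orthogonal idempotents. -/
theorem sum_secondEigenmatrix_mul (hr : 0 < r) (hk : k ≤ n) (a b : domain n k)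
    (x z : Vertex r n k) :
    ∑ y : Vertex r n k, secondEigenmatrix r n k a (relation r n k x y) *
        secondEigenmatrix r n k b (relation r n k y z) =
      if a = b then (Fintype.card (Vertex r n k) : ℝ) *
        secondEigenmatrix r n k a (relation r n k x z) else 0 := by
  obtain ⟨⟨i, j⟩, ha⟩ := a
  obtain ⟨⟨i', j'⟩, hb⟩ := b
  rw [mem_domain] at ha hb
  set X := support x.1 with hX
  set Z := support z.1 with hZ
  have hXk : #X = k := card_support x
  have hZk : #Z = k := card_support z
  set κ : ℕ → ℝ := fun i => (n.choose i : ℝ) / (k.choose i : ℝ) with hκ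
  -- The middle vectors are grouped by support `T`: the Hahn factors are constant on a group, and
  -- only `U = U'` survives the sum over symbols.
  have e1 : ∑ y : Vertex r n k, secondEigenmatrix r n k (i, j) (relation r n k x y) *
        secondEigenmatrix r n k (i', j') (relation r n k y z) =
      ∑ T ∈ (univ : Finset (Fin n)).powersetCard k,
        ∑ U ∈ (X ∩ T).powersetCard i, ∑ U' ∈ (T ∩ Z).powersetCard i',
          κ i * κ i' * (hahn j (n - i) (k - i) #(T \ X) * hahn j' (n - i') (k - i') #(T \ Z)) *
          (if U = U' then ((r - 1 : ℕ) : ℝ) ^ k * ∏ l ∈ U, symbolKernel (x.1 l) (z.1 l) else 0) := by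
    calc _ = ∑ y : Vertex r n k, κ i * κ i' *
          (hahn j (n - i) (k - i) #(support y.1 \ X) *
            hahn j' (n - i') (k - i') #(support y.1 \ Z)) *
          ((∑ U ∈ (X ∩ support y.1).powersetCard i, ∏ l ∈ U, symbolKernel (x.1 l) (y.1 l)) *
          ∑ U ∈ (support y.1 ∩ Z).powersetCard i', ∏ l ∈ U, symbolKernel (y.1 l) (z.1 l)) := by
          refine Finset.sum_congr rfl fun y _ => ?_
          rw [secondEigenmatrix_relation, secondEigenmatrix_relation,
            Finset.card_sdiff_comm (s := support x.1) (t := support y.1)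
              ((card_support x).trans (card_support y).symm)]
          simp only [hκ]
          ring
      _ = ∑ T ∈ (univ : Finset (Fin n)).powersetCard k,
            ∑ y : Fin n → Fin r with support y = T, κ i * κ i' *
          (hahn j (n - i) (k - i) #(support y \ X) *
            hahn j' (n - i') (k - i') #(support y \ Z)) *
          ((∑ U ∈ (X ∩ support y).powersetCard i, ∏ l ∈ U, symbolKernel (x.1 l) (y l)) *
          ∑ U ∈ (support y ∩ Z).powersetCard i', ∏ l ∈ U, symbolKernel (y l) (z.1 l)) :=
          sum_vertex (fun y => κ i * κ i' *
          (hahn j (n - i) (k - i) #(support y \ X) *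
            hahn j' (n - i') (k - i') #(support y \ Z)) *
          ((∑ U ∈ (X ∩ support y).powersetCard i, ∏ l ∈ U, symbolKernel (x.1 l) (y l)) *
          ∑ U ∈ (support y ∩ Z).powersetCard i', ∏ l ∈ U, symbolKernel (y l) (z.1 l)))
      _ = _ := by
          refine Finset.sum_congr rfl fun T hT => ?_
          rw [mem_powersetCard] at hT
          calc _ = ∑ y : Fin n → Fin r with support y = T, κ i * κ i' *
                (hahn j (n - i) (k - i) #(T \ X) * hahn j' (n - i') (k - i') #(T \ Z)) *
                ((∑ U ∈ (X ∩ T).powersetCard i, ∏ l ∈ U, symbolKernel (x.1 l) (y l)) *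
                ∑ U ∈ (T ∩ Z).powersetCard i', ∏ l ∈ U, symbolKernel (y l) (z.1 l)) := by
                refine Finset.sum_congr rfl fun y hy => ?_
                rw [(mem_filter.1 hy).2]
            _ = _ := by
                simp only [Finset.sum_mul_sum]
                simp only [Finset.mul_sum]
                rw [Finset.sum_comm]
                refine Finset.sum_congr rfl fun U hU => ?_
                rw [Finset.sum_comm]
                refine Finset.sum_congr rfl fun U' hU' => ?_
                rw [mem_powersetCard, subset_inter_iff] at hU hU'
                rw [← Finset.mul_sum,
                  sum_prod_symbolKernel hr hU.1.1 hU.1.2 hU'.1.2 hU'.1.1, hT.2]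
  rw [e1]
  by_cases hi : i = i'
  swap
  · rw [if_neg (by simp [hi])]
    refine Finset.sum_eq_zero fun T _ => Finset.sum_eq_zero fun U hU =>
      Finset.sum_eq_zero fun U' hU' => ?_
    rw [mem_powersetCard] at hU hU'
    rw [if_neg, mul_zero]
    rintro rfl
    exact hi (hU.2.symm.trans hU'.2)
  subst hi
  have e2 : ∀ T ∈ (univ : Finset (Fin n)).powersetCard k,
      (∑ U ∈ (X ∩ T).powersetCard i, ∑ U' ∈ (T ∩ Z).powersetCard i,
          κ i * κ i * (hahn j (n - i) (k - i) #(T \ X) * hahn j' (n - i) (k - i) #(T \ Z)) *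
          (if U = U' then ((r - 1 : ℕ) : ℝ) ^ k *
            ∏ l ∈ U, symbolKernel (x.1 l) (z.1 l) else 0)) =
      ∑ U ∈ (X ∩ T ∩ Z).powersetCard i,
          κ i * κ i * (hahn j (n - i) (k - i) #(T \ X) * hahn j' (n - i) (k - i) #(T \ Z)) *
          (((r - 1 : ℕ) : ℝ) ^ k * ∏ l ∈ U, symbolKernel (x.1 l) (z.1 l)) := by
    intro T _
    simp only [mul_ite, mul_zero, Finset.sum_ite_eq]
    rw [← Finset.sum_filter]
    refine Finset.sum_congr ?_ fun _ _ => rfl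
    ext U
    simp only [mem_filter, mem_powersetCard, subset_inter_iff]
    tauto
  -- For fixed `U` the support `T` runs over all `k`-sets containing `U`, where Johnson
  -- orthogonality applies.
  rw [Finset.sum_congr rfl e2, Finset.sum_comm' (t' := (X ∩ Z).powersetCard i)
    (s' := fun U => supersets U k)]
  swap
  · intro T U
    simp only [mem_powersetCard, subset_inter_iff, mem_supersets, subset_univ, true_and]
    tauto
  have hik : i ≤ k := by omega
  have hkn : k + j ≤ n := by omega
  have hkn' : k + j' ≤ n := by omega
  have e3 : ∀ U ∈ (X ∩ Z).powersetCard i,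
      ∑ T ∈ supersets U k, κ i * κ i *
          (hahn j (n - i) (k - i) #(T \ X) * hahn j' (n - i) (k - i) #(T \ Z)) *
          (((r - 1 : ℕ) : ℝ) ^ k * ∏ l ∈ U, symbolKernel (x.1 l) (z.1 l)) =
      κ i * κ i * (if j = j' then ((n - i).choose (k - i) : ℝ) *
        hahn j (n - i) (k - i) #(X \ Z) else 0) *
          (((r - 1 : ℕ) : ℝ) ^ k * ∏ l ∈ U, symbolKernel (x.1 l) (z.1 l)) := by
    intro U hU
    rw [mem_powersetCard, subset_inter_iff] at hU
    rw [← Finset.sum_mul, ← Finset.mul_sum]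
    congr 2
    have := sum_hahn_mul_hahn (U := U) (X := X) (Z := Z) (k := k) (j := j) (j' := j')
      (mem_supersets.2 ⟨hU.1.1, hXk⟩) (mem_supersets.2 ⟨hU.1.2, hZk⟩) (by omega)
      (by rw [Fintype.card_fin]; exact hkn) (by omega) (by rw [Fintype.card_fin]; exact hkn')
    rwa [hU.2, Fintype.card_fin] at this
  rw [Finset.sum_congr rfl e3]
  by_cases hj : j = j'
  · subst hj
    simp only [if_true]
    rw [card_vertex hr, secondEigenmatrix_relation, ← Finset.mul_sum, ← Finset.mul_sum]
    -- One factor `binom n i / binom k i` converts the Johnson constant into the `binom n k` of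
    -- `|S|`.
    have hc : κ i * ((n - i).choose (k - i) : ℝ) = (n.choose k : ℝ) := by
      have h1 : (k.choose i : ℝ) ≠ 0 := by exact_mod_cast (Nat.choose_pos hik).ne'
      have h2 : (n.choose k : ℝ) * (k.choose i : ℝ) =
          (n.choose i : ℝ) * ((n - i).choose (k - i) : ℝ) := by
        exact_mod_cast Nat.choose_mul hik
      simp only [hκ]
      field_simp
      linear_combination -h2
    simp only [← hX, ← hZ]
    rw [← hc]
    simp only [hκ]
    ring
  · simp [hj]

theorem relation_self (x : Vertex r n k) :
    ((relation r n k x x : domain n k) : ℕ × ℕ) = (0, 0) := by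
  have h1 : commonNonzero x.1 x.1 = k := by
    rw [commonNonzero_eq, inter_self, card_support]
  have h2 : equalNonzero x.1 x.1 = k := by
    have := x.2
    simpa [equalNonzero, weight] using this
  simp [relation, h1, h2]

/-- The value is `binom n i * (r - 2)^i` times the Johnson multiplicity for `n - i`; `r > 2` keeps
it nonzero. -/
theorem secondEigenmatrix_zero_ne_zero (hr : 2 < r) (hk : k ≤ n) (a : domain n k) :
    secondEigenmatrix r n k a (0, 0) ≠ 0 := by
  obtain ⟨⟨i, j⟩, ha⟩ := a
  rw [mem_domain] at ha
  have h1 : (n.choose i : ℝ) ≠ 0 := by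
    exact_mod_cast (Nat.choose_pos (show i ≤ n by omega)).ne'
  have h2 : (k.choose i : ℝ) ≠ 0 := by
    exact_mod_cast (Nat.choose_pos (show i ≤ k by omega)).ne'
  have h3 := (johnsonMult_pos (j := j) (N := n - i) (by omega)).ne'
  have h4 : (((r - 1 : ℕ) : ℝ) - 1) ≠ 0 := by
    have : (2 : ℝ) ≤ ((r - 1 : ℕ) : ℝ) := by exact_mod_cast (show 2 ≤ r - 1 by omega)
    linarith
  simp only [secondEigenmatrix, Nat.sub_zero, krawtchouk_at_zero, hahn_eq, diagCoeff_zero,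
    Nat.choose_zero_right, Nat.cast_one, mul_one, div_one]
  positivity

end Eigenmatrix

/-! ### Schemes and Krein numbers from a full set of orthogonal idempotents -/

section OrthogonalIdempotents

variable {X I : Type*} [Fintype X] [DecidableEq X] [Fintype I] [DecidableEq I]

theorem sum_smul_mul_sum_smul {E : I → Matrix X X ℂ}
    (hE : ∀ a b, E a * E b = if a = b then E a else 0) (c d : I → ℂ) :
    (∑ a, c a • E a) * ∑ a, d a • E a = ∑ a, (c a * d a) • E a := by
  rw [Finset.sum_mul_sum]
  refine Finset.sum_congr rfl fun a _ => ?_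
  rw [Finset.sum_eq_single a]
  · rw [smul_mul_smul_comm, hE, if_pos rfl]
  · intro b _ hb
    rw [smul_mul_smul_comm, hE, if_neg (Ne.symm hb), smul_zero]
  · simp

theorem mul_sum_smul {E : I → Matrix X X ℂ}
    (hE : ∀ a b, E a * E b = if a = b then E a else 0) (a : I) (c : I → ℂ) :
    E a * ∑ b, c b • E b = c a • E a := by
  rw [Finset.mul_sum, Finset.sum_eq_single a]
  · rw [mul_smul_comm, hE, if_pos rfl]
  · intro b _ hb
    rw [mul_smul_comm, hE, if_neg (Ne.symm hb), smul_zero]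
  · simp

theorem linearIndependent_of_orthogonal {E : I → Matrix X X ℂ}
    (hE : ∀ a b, E a * E b = if a = b then E a else 0) (h0 : ∀ a, E a ≠ 0) :
    LinearIndependent ℂ E := by
  rw [Fintype.linearIndependent_iff]
  intro g hg a
  have h1 := mul_sum_smul hE a g
  rw [hg, mul_zero] at h1
  exact (smul_eq_zero.1 h1.symm).resolve_right (h0 a)

variable {R : X → X → I} {E : I → Matrix X X ℂ}

/-- The `E a` are independent and as many as the generators of the span, so the dimensions agree. -/
theorem span_eq_boseMesner (hmem : ∀ a, E a ∈ boseMesner R)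
    (hE : ∀ a b, E a * E b = if a = b then E a else 0) (h0 : ∀ a, E a ≠ 0) :
    Submodule.span ℂ (Set.range E) = boseMesner R := by
  refine Submodule.eq_of_le_of_finrank_le ?_ ?_
  · rw [Submodule.span_le]
    rintro _ ⟨a, rfl⟩
    exact hmem a
  · rw [finrank_span_eq_card (linearIndependent_of_orthogonal hE h0)]
    exact finrank_range_le_card (R := ℂ) (adjacency R)

/-- The same count makes the adjacency matrices independent, hence nonzero, so no relation is empty.
-/
theorem surjective_of_orthogonal (hmem : ∀ a, E a ∈ boseMesner R)
    (hE : ∀ a b, E a * E b = if a = b then E a else 0) (h0 : ∀ a, E a ≠ 0) (i : I) :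
    ∃ x y, R x y = i := by
  have h1 : LinearIndependent ℂ (adjacency R) := by
    rw [linearIndependent_iff_card_eq_finrank_span, Set.finrank]
    have h2 := span_eq_boseMesner hmem hE h0
    rw [boseMesner] at h2
    rw [← h2, finrank_span_eq_card (linearIndependent_of_orthogonal hE h0)]
  by_contra h
  push Not at h
  refine h1.ne_zero i ?_
  ext x y
  simp [adjacency, h x y]

/-- In the basis `E` multiplication is coordinatewise, so the span is closed and commutative. -/
theorem isSymmetricAssociationScheme_of_orthogonal (hmem : ∀ a, E a ∈ boseMesner R)
    (hE : ∀ a b, E a * E b = if a = b then E a else 0) (h0 : ∀ a, E a ≠ 0)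
    (hone : ∃ i, adjacency R i = 1) (hsymm : ∀ x y, R x y = R y x) :
    IsSymmetricAssociationScheme R := by
  have hspan := span_eq_boseMesner hmem hE h0
  have hA : ∀ i, ∃ c : I → ℂ, ∑ a, c a • E a = adjacency R i := fun i => by
    rw [← Submodule.mem_span_range_iff_exists_fun, hspan]
    exact Submodule.subset_span ⟨i, rfl⟩
  refine ⟨surjective_of_orthogonal hmem hE h0, hone, ?_, ?_, ?_⟩
  · intro i
    ext x y
    simp [adjacency, hsymm x y]
  · intro i j
    obtain ⟨c, hc⟩ := hA i
    obtain ⟨d, hd⟩ := hA j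
    have h1 : adjacency R i * adjacency R j ∈ Submodule.span ℂ (Set.range (adjacency R)) := by
      change _ ∈ boseMesner R
      rw [← hspan, ← hc, ← hd, sum_smul_mul_sum_smul hE, Submodule.mem_span_range_iff_exists_fun]
      exact ⟨_, rfl⟩
    rw [Submodule.mem_span_range_iff_exists_fun] at h1
    obtain ⟨p, hp⟩ := h1
    exact ⟨p, hp.symm⟩
  · intro i j
    obtain ⟨c, hc⟩ := hA i
    obtain ⟨d, hd⟩ := hA j
    rw [← hc, ← hd, sum_smul_mul_sum_smul hE, sum_smul_mul_sum_smul hE]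
    simp only [mul_comm]

/-- In the basis `E` idempotents are `0`-`1` vectors, and the minimal nonzero ones are the unit
vectors. -/
theorem enumeratesPrimitiveIdempotents_of_orthogonal (hmem : ∀ a, E a ∈ boseMesner R)
    (hE : ∀ a b, E a * E b = if a = b then E a else 0) (h0 : ∀ a, E a ≠ 0) :
    EnumeratesPrimitiveIdempotents R E := by
  have hspan := span_eq_boseMesner hmem hE h0
  have hli := linearIndependent_of_orthogonal hE h0
  refine ⟨hli.injective, fun e => ⟨?_, ?_⟩⟩
  · rintro ⟨heV, he0, hee, hmin⟩
    rw [← hspan, Submodule.mem_span_range_iff_exists_fun] at heV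
    obtain ⟨c, rfl⟩ := heV
    obtain ⟨a, ha⟩ : ∃ a, c a ≠ 0 := by
      by_contra h
      push Not at h
      exact he0 (by simp [h])
    have hca : c a = 1 := by
      have h1 := congrArg (E a * ·) hee
      simp only [sum_smul_mul_sum_smul hE, mul_sum_smul hE] at h1
      have h2 := smul_left_injective ℂ (h0 a) h1
      exact mul_left_cancel₀ ha (by rw [mul_one]; exact h2)
    have h1 : E a * ∑ b, c b • E b = E a := by rw [mul_sum_smul hE, hca, one_smul]
    have h2 : (∑ b, c b • E b) * E a = E a := by
      have h3 : E a = ∑ b, (if b = a then (1 : ℂ) else 0) • E b := by simp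
      have h4 := sum_smul_mul_sum_smul hE c (fun b => if b = a then (1 : ℂ) else 0)
      rw [← h3] at h4
      rw [h4]
      simp [hca]
    rcases hmin (E a) (hmem a) (by rw [hE, if_pos rfl]) h2 h1 with h | h
    · exact absurd h (h0 a)
    · exact ⟨a, h⟩
  · rintro ⟨a, rfl⟩
    refine ⟨hmem a, h0 a, by rw [hE, if_pos rfl], ?_⟩
    intro f hf hff haf _
    rw [← hspan, Submodule.mem_span_range_iff_exists_fun] at hf
    obtain ⟨c, rfl⟩ := hf
    rw [mul_sum_smul hE] at haf
    rw [← haf, smul_mul_smul_comm, hE, if_pos rfl] at hff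
    have h2 := smul_left_injective ℂ (h0 a) hff
    rw [← haf]
    rcases eq_or_ne (c a) 0 with h | h
    · left; rw [h, zero_smul]
    · right
      rw [mul_left_cancel₀ h (show c a * c a = c a * 1 by rw [mul_one]; exact h2), one_smul]

/-- Rows of a second eigenmatrix are linearly independent over the reals. -/
theorem linearIndependent_rows {X I : Type*} [Fintype I] [DecidableEq I]
    {R : X → X → I} {E : I → Matrix X X ℂ} {Q : I → I → ℝ} {N : ℂ}
    (hEQ : ∀ a, E a = N • ∑ b, ((Q a b : ℝ) : ℂ) • adjacency R b)
    (hli : LinearIndependent ℂ E) : LinearIndependent ℝ Q := by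
  rw [Fintype.linearIndependent_iff] at hli ⊢
  intro g hg a
  have h1 : ∑ a, ((g a : ℝ) : ℂ) • E a = 0 := by
    simp only [hEQ, Finset.smul_sum, smul_smul]
    rw [Finset.sum_comm]
    refine Finset.sum_eq_zero fun b _ => ?_
    rw [← Finset.sum_smul]
    have h2 : ∑ a, g a * Q a b = 0 := by
      have := congrFun hg b
      simpa using this
    have h3 : ∑ a, ((g a : ℝ) : ℂ) * (N * ((Q a b : ℝ) : ℂ)) = N * ((∑ a, g a * Q a b : ℝ) : ℂ) := by
      push_cast
      rw [Finset.mul_sum]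
      exact Finset.sum_congr rfl fun a _ => by ring
    rw [h3, h2]
    simp
  exact_mod_cast hli _ h1 a

/-- The entry at `(x, y)` involves only `s = R x y`, and every `s` occurs. -/
theorem isKreinNumbers_iff {X I : Type*} [Fintype X] [Nonempty X] [Fintype I] [DecidableEq I]
    {R : X → X → I} {E : I → Matrix X X ℂ} {Q : I → I → ℝ}
    (hEQ : ∀ a, E a = (Fintype.card X : ℂ)⁻¹ • ∑ b, ((Q a b : ℝ) : ℂ) • adjacency R b)
    (hsurj : ∀ i, ∃ x y, R x y = i) (q : I → I → I → ℝ) :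
    IsKreinNumbers E q ↔ ∀ a b s, Q a s * Q b s = ∑ c, q a b c * Q c s := by
  have hent : ∀ a x y, ((Fintype.card X : ℂ) • E a) x y = ((Q a (R x y) : ℝ) : ℂ) := by
    intro a x y
    have h0 : (Fintype.card X : ℂ) ≠ 0 := by exact_mod_cast Fintype.card_ne_zero
    rw [hEQ, smul_smul, mul_inv_cancel₀ h0, one_smul, Matrix.sum_apply]
    simp [adjacency]
  constructor
  · intro h a b s
    obtain ⟨x, y, rfl⟩ := hsurj s
    have h1 := congrFun (congrFun (h a b) x) y
    rw [Matrix.hadamard_apply, hent, hent, Matrix.sum_apply] at h1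
    simp only [Matrix.smul_apply (_ : ℂ) (_ • _ : Matrix X X ℂ), hent, smul_eq_mul] at h1
    exact_mod_cast h1
  · intro h a b
    ext x y
    rw [Matrix.hadamard_apply, hent, hent, Matrix.sum_apply]
    simp only [Matrix.smul_apply (_ : ℂ) (_ • _ : Matrix X X ℂ), hent, smul_eq_mul]
    exact_mod_cast h a b (R x y)

/-- The independent rows, being as many as the columns, span all functions on `I`. -/
theorem exists_kreinNumbers {I : Type*} [Fintype I] {Q : I → I → ℝ} (hQ : LinearIndependent ℝ Q) :
    ∃ q : I → I → I → ℝ, ∀ a b s, Q a s * Q b s = ∑ c, q a b c * Q c s := by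
  have htop : Submodule.span ℝ (Set.range Q) = ⊤ :=
    hQ.span_eq_top_of_card_eq_finrank' (by simp)
  have h : ∀ a b, ∃ c : I → ℝ, ∑ l, c l • Q l = fun s => Q a s * Q b s := fun a b => by
    rw [← Submodule.mem_span_range_iff_exists_fun, htop]
    trivial
  choose q hq using h
  refine ⟨q, fun a b s => ?_⟩
  have := congrFun (hq a b) s
  simpa using this.symm

theorem eq_of_sum_mul_eq {I : Type*} [Fintype I] {Q : I → I → ℝ} (hQ : LinearIndependent ℝ Q) {v w : I → ℝ}
    (h : ∀ s, ∑ c, v c * Q c s = ∑ c, w c * Q c s) : v = w := by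
  rw [Fintype.linearIndependent_iff] at hQ
  funext a
  refine sub_eq_zero.1 (hQ (fun c => v c - w c) ?_ a)
  funext s
  have := h s
  simp only [Finset.sum_apply, Pi.smul_apply, smul_eq_mul, sub_mul, Finset.sum_sub_distrib,
    Pi.zero_apply, this, sub_self]

end OrthogonalIdempotents

/-! ### The matrices `E_{ij}` as orthogonal idempotents -/

section Scheme

variable {r n k : ℕ}

theorem idempotent_mem (a : domain n k) : idempotent r n k a ∈ boseMesner (relation r n k) :=
  Submodule.smul_mem _ _ (Submodule.sum_mem _ fun b _ =>
    Submodule.smul_mem _ _ (Submodule.subset_span ⟨b, rfl⟩))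

theorem idempotent_apply (a : domain n k) (x y : Vertex r n k) :
    idempotent r n k a x y = (Fintype.card (Vertex r n k) : ℂ)⁻¹ *
      ((secondEigenmatrix r n k a (relation r n k x y) : ℝ) : ℂ) := by
  rw [idempotent, Matrix.smul_apply, Matrix.sum_apply]
  simp [adjacency]

theorem nonempty_vertex (hr : 2 < r) (hk : k ≤ n) : Nonempty (Vertex r n k) := by
  rw [← Fintype.card_pos_iff]
  have h1 := card_vertex (r := r) (n := n) (k := k) (by omega)
  have h2 : 0 < n.choose k := Nat.choose_pos hk
  have h3 : 0 < r - 1 := by omega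
  have h4 : (0 : ℝ) < Fintype.card (Vertex r n k) := by rw [h1]; positivity
  exact_mod_cast h4

theorem idempotent_mul (hr : 2 < r) (hk : k ≤ n) (a b : domain n k) :
    idempotent r n k a * idempotent r n k b = if a = b then idempotent r n k a else 0 := by
  have := nonempty_vertex hr hk
  have h0 : (Fintype.card (Vertex r n k) : ℂ) ≠ 0 := by exact_mod_cast Fintype.card_ne_zero
  ext x z
  rw [Matrix.mul_apply]
  have h1 := congrArg (fun t : ℝ => (t : ℂ))
    (sum_secondEigenmatrix_mul (show 0 < r by omega) hk a b x z)
  push_cast at h1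
  calc _ = (Fintype.card (Vertex r n k) : ℂ)⁻¹ * (Fintype.card (Vertex r n k) : ℂ)⁻¹ *
        ∑ y : Vertex r n k, ((secondEigenmatrix r n k a (relation r n k x y) : ℝ) : ℂ) *
          ((secondEigenmatrix r n k b (relation r n k y z) : ℝ) : ℂ) := by
        rw [Finset.mul_sum]
        refine Finset.sum_congr rfl fun y _ => ?_
        rw [idempotent_apply, idempotent_apply]
        ring
    _ = _ := by
        rw [h1]
        split_ifs
        · rw [idempotent_apply]
          push_cast
          field_simp
        · simp

theorem idempotent_ne_zero (hr : 2 < r) (hk : k ≤ n) (a : domain n k) :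
    idempotent r n k a ≠ 0 := by
  have := nonempty_vertex hr hk
  have h0 : (Fintype.card (Vertex r n k) : ℂ) ≠ 0 := by exact_mod_cast Fintype.card_ne_zero
  obtain ⟨x⟩ := nonempty_vertex hr hk
  intro h
  have h1 := congrFun (congrFun h x) x
  rw [idempotent_apply, relation_self, Matrix.zero_apply] at h1
  rcases mul_eq_zero.1 h1 with h2 | h2
  · exact inv_ne_zero h0 h2
  · exact secondEigenmatrix_zero_ne_zero hr hk a (by exact_mod_cast h2)

theorem relation_comm (x y : Vertex r n k) : relation r n k x y = relation r n k y x := by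
  have h1 : commonNonzero x.1 y.1 = commonNonzero y.1 x.1 := by
    simp only [commonNonzero, and_comm]
  have h2 : equalNonzero x.1 y.1 = equalNonzero y.1 x.1 := by
    rw [equalNonzero, equalNonzero]
    congr 1
    ext l
    simp only [mem_filter, mem_univ, true_and]
    constructor <;> (rintro ⟨h, h'⟩; exact ⟨h.symm, by rw [h] at *; exact h'⟩)
  simp only [relation, h1, h2]

/-- `c = k` forces equal supports, and `e = k` equal entries on them. -/
theorem adjacency_zero_eq_one :
    adjacency (relation r n k) ⟨(0, 0), mem_domain.2 (by omega)⟩ = 1 := by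
  ext x y
  rw [adjacency, Matrix.of_apply, Matrix.one_apply]
  congr 1
  rw [relation_eq_iff, eq_iff_iff]
  constructor
  · rintro ⟨h1, h2⟩
    have hy : equalNonzero x.1 y.1 = #(support y.1) := by
      rw [card_support]; push_cast at h1; omega
    have hx : commonNonzero x.1 y.1 = #(support x.1) := by
      rw [card_support]; push_cast at h2; omega
    have hy' : (univ.filter fun l => x.1 l = y.1 l ∧ (y.1 l).val ≠ 0) = support y.1 :=
      eq_of_subset_of_card_le (fun l hl => mem_support.2 (mem_filter.1 hl).2.2) hy.ge
    have hx' : (univ.filter fun l => (x.1 l).val ≠ 0 ∧ (y.1 l).val ≠ 0) = support x.1 :=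
      eq_of_subset_of_card_le (fun l hl => mem_support.2 (mem_filter.1 hl).2.1) hx.ge
    refine Subtype.ext (funext fun l => ?_)
    by_cases hl : (y.1 l).val ≠ 0
    · have : l ∈ support y.1 := mem_support.2 hl
      rw [← hy', mem_filter] at this
      exact this.2.1
    · have : l ∉ support x.1 := by
        rw [← hx', mem_filter]
        exact fun h => hl h.2.2
      rw [mem_support] at this
      exact Fin.ext (by omega)
  · rintro rfl
    have h := relation_self x
    have h1 : relation r n k x x = ⟨(0, 0), mem_domain.2 (by omega)⟩ := Subtype.ext h
    exact (relation_eq_iff x x _).1 h1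

end Scheme

/-! ### Products of rows of the second eigenmatrix -/

variable {r n k : ℕ}

theorem hahn_zero {N p y : ℕ} (h : y ≤ p) (h' : y ≤ N - p) : hahn 0 N p y = 1 := by
  have h1 : (p.choose y : ℝ) ≠ 0 := by exact_mod_cast (Nat.choose_pos h).ne'
  have h2 : ((N - p).choose y : ℝ) ≠ 0 := by exact_mod_cast (Nat.choose_pos h').ne'
  have h3 : diagCoeff 0 p (N - p) y = (p.choose y : ℝ) * ((N - p).choose y : ℝ) := by
    rw [diagCoeff, Finset.sum_eq_single (0, y)]
    · simp
    · intro b hb hb'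
      rw [HasAntidiagonal.mem_antidiagonal] at hb
      rcases Nat.eq_zero_or_pos b.1 with h | h
      · exact absurd (Prod.ext h (by simp; omega)) hb'
      · simp [Nat.choose_eq_zero_of_lt h]
    · intro h
      simp at h
  rw [hahn_eq, Nat.sub_zero, Nat.sub_zero, h3, johnsonMult]
  simp only [Nat.choose_zero_right, Nat.cast_one, if_true, sub_zero]
  field_simp

/-- The recurrence at `j = 0` expresses `H_1` through `H_0 = 1`; hence `Q_{01}` is affine in `y`. -/
theorem hahn_one {N p y : ℕ} (hp : 0 < p) (hpN : p < N) (h : y ≤ p) (h' : y ≤ N - p) :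
    hahn 1 N p y = (N - 1) - (N : ℝ) * (N - 1) / (p * (N - p)) * y := by
  have h1 := hahn_three_term (j := 0) (Nat.zero_le p) (show p + 0 ≤ N by omega) h
  rw [hahn_zero h h', if_pos rfl] at h1
  have c1 : (0 : ℝ) < p := by exact_mod_cast hp
  have c2 : (p : ℝ) + 1 ≤ N := by exact_mod_cast hpN
  have n0 : (N : ℝ) ≠ 0 := by linarith
  have n1 : (N : ℝ) - 1 ≠ 0 := by linarith
  have n2 : (N : ℝ) - p ≠ 0 := by linarith
  have n3 : (N : ℝ) + 1 ≠ 0 := by linarith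
  have n4 : (p : ℝ) ≠ 0 := by linarith
  simp only [Nat.cast_zero, mul_zero, sub_zero, zero_mul, zero_add, zero_div, add_zero] at h1
  field_simp at h1 ⊢
  linear_combination h1

theorem choose_div_choose_succ {i : ℕ} (hi : i < k) :
    (n.choose (i + 1) : ℝ) / (k.choose (i + 1) : ℝ) =
      (n.choose i : ℝ) / (k.choose i : ℝ) * ((n : ℝ) - i) / ((k : ℝ) - i) := by
  have h1 := succ_mul_choose_succ n i
  have h2 := succ_mul_choose_succ k i
  have h3 : (k.choose i : ℝ) ≠ 0 := by exact_mod_cast (Nat.choose_pos hi.le).ne'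
  have h4 : (k.choose (i + 1) : ℝ) ≠ 0 := by exact_mod_cast (Nat.choose_pos hi).ne'
  have h5 : (k : ℝ) - i ≠ 0 := by
    have : (i : ℝ) + 1 ≤ k := by exact_mod_cast hi
    linarith
  have h6 : (i : ℝ) + 1 ≠ 0 := by positivity
  field_simp
  apply mul_left_cancel₀ h6
  linear_combination (((k : ℝ) - i) * (k.choose i : ℝ)) * h1 -
    ((n.choose i : ℝ) * ((n : ℝ) - i)) * h2

/-- A recurrence may name indices outside `𝒟`; it is still an expansion in rows indexed by `𝒟` if
their coefficients vanish. -/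
theorem sum_domain_ite {p : ℕ × ℕ} {C : ℝ} (f : ℕ × ℕ → ℝ) (h : p ∉ domain n k → C = 0) :
    ∑ c : domain n k, (if (c : ℕ × ℕ) = p then C else 0) * f c = C * f p := by
  rw [Finset.sum_coe_sort (domain n k) fun c => (if c = p then C else 0) * f c]
  simp only [ite_mul, zero_mul]
  rw [Finset.sum_ite_eq']
  split_ifs with hp
  · rfl
  · rw [h hp, zero_mul]

/-- Raising the first index: the contribution of `K_{i+1}` to `Q_{10} Q_{ij}`. -/
theorem eigenmatrix_raise {i j x y : ℕ} (hk : k ≤ n) (hij : i + j ≤ k) (hj : j ≤ n - k)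
    (hxy : x + y ≤ k) (h0 : 0 < k) :
    (n : ℝ) / k * ((n.choose i : ℝ) / (k.choose i : ℝ) *
        (((i : ℝ) + 1) * krawtchouk (i + 1) (k - y) (r - 1) x) * hahn j (n - i) (k - i) y) =
      (n : ℝ) * (i + 1) * (k - i - j) / (k * (n - i - 2 * j)) *
          secondEigenmatrix r n k (i + 1, j) (x, y) +
        (if j = 0 then 0 else (n : ℝ) * (i + 1) * (n - k - j + 1) / (k * (n - i - 2 * j + 2))) *
          secondEigenmatrix r n k (i + 1, j - 1) (x, y) := by
  simp only [secondEigenmatrix]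
  -- If `K_{i+1}` does not vanish identically, then `y ≤ k - i - 1`, as `hahn_down` requires.
  by_cases hi : k - y < i + 1
  · rw [krawtchouk_eq_zero (by omega) hi]; simp
  have hik : i < k := by omega
  obtain ⟨p, rfl⟩ : ∃ p, k = p + i + 1 := ⟨k - i - 1, by omega⟩
  obtain ⟨N, rfl⟩ : ∃ N, n = N + i + 1 := ⟨n - i - 1, by omega⟩
  rw [choose_div_choose_succ hik, show N + i + 1 - i = N + 1 by omega,
    show p + i + 1 - i = p + 1 by omega, show N + i + 1 - (i + 1) = N by omega,
    show p + i + 1 - (i + 1) = p by omega,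
    hahn_down (show j ≤ p + 1 by omega) (show p + j ≤ N by omega) (show y ≤ p by omega)]
  push_cast
  rcases j with _ | j
  · simp only [if_true]; push_cast; simp only [div_eq_mul_inv, mul_inv]; ring
  · rw [if_neg (by omega), if_neg (by omega)]; push_cast; simp only [div_eq_mul_inv, mul_inv]; ring

/-- Lowering the first index: the contribution of `K_{i-1}` to `Q_{10} Q_{ij}`. -/
theorem eigenmatrix_lower {i j x y : ℕ} (hr : 0 < r) (hk : k ≤ n) (hij : i + 1 + j ≤ k)
    (hj : j ≤ n - k) (hxy : x + y ≤ k) :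
    (n : ℝ) / k * ((n.choose (i + 1) : ℝ) / (k.choose (i + 1) : ℝ) *
        ((((r - 1 : ℕ) : ℝ) - 1) * (((k - y : ℕ) : ℝ) - (i + 1 : ℕ) + 1) *
          krawtchouk i (k - y) (r - 1) x) * hahn j (n - (i + 1)) (k - (i + 1)) y) =
      (n : ℝ) * (r - 2) * (n - (i + 1 : ℕ) - j + 2) * (k - (i + 1 : ℕ) - j + 1) /
          (k * (n - (i + 1 : ℕ) - 2 * j + 2)) * secondEigenmatrix r n k (i, j) (x, y) +
        (n : ℝ) * (r - 2) * (j + 1) * (n - k - j) / (k * (n - (i + 1 : ℕ) - 2 * j)) *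
          secondEigenmatrix r n k (i, j + 1) (x, y) := by
  simp only [secondEigenmatrix]
  by_cases hi : k - y < i
  · rw [krawtchouk_eq_zero (by omega) hi]; simp
  obtain ⟨p, rfl⟩ : ∃ p, k = p + i + 1 := ⟨k - i - 1, by omega⟩
  obtain ⟨N, rfl⟩ : ∃ N, n = N + i + 1 := ⟨n - i - 1, by omega⟩
  have hup := hahn_up (N := N) (p := p) (j := j) (y := y) (by omega) (by omega) (by omega)
  rw [choose_div_choose_succ (by omega), show N + i + 1 - i = N + 1 by omega,
    show p + i + 1 - i = p + 1 by omega, show N + i + 1 - (i + 1) = N by omega,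
    show p + i + 1 - (i + 1) = p by omega]
  rw [Nat.cast_sub (show y ≤ p + i + 1 by omega), Nat.cast_sub (show 1 ≤ r from hr)]
  have hp : (p : ℝ) + 1 ≠ 0 := by positivity
  have hN : (N : ℝ) + 1 ≠ 0 := by positivity
  push_cast
  set K := krawtchouk i (p + i + 1 - y) (r - 1) x
  set κ : ℝ := ((N + i + 1).choose i : ℝ) / ((p + i + 1).choose i : ℝ)
  set H1 := hahn j (N + 1) (p + 1) y
  set H2 := hahn (j + 1) (N + 1) (p + 1) y
  -- The Krawtchouk coefficient `k - y - i` equals `p + 1 - y`, the factor consumed by `hahn_up`.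
  calc _ = ((N : ℝ) + i + 1) / (p + i + 1) * (κ * ((N : ℝ) + 1) / ((p : ℝ) + 1) * ((r : ℝ) - 2) * K *
        (((p : ℝ) + 1 - y) * hahn j N p y)) := by ring
    _ = ((N : ℝ) + i + 1) / (p + i + 1) * κ * ((r : ℝ) - 2) * K *
        (((N : ℝ) + 1) / ((N : ℝ) + 1)) * (((p : ℝ) + 1) / ((p : ℝ) + 1)) *
        (((p : ℝ) - j + 1) * (N + 2 - j) / (N + 2 - 2 * j) * H1 +
          ((N : ℝ) - p - j) * (j + 1) / (N - 2 * j) * H2) := by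
        rw [hup]; simp only [div_eq_mul_inv, mul_inv]; ring
    _ = _ := by rw [div_self hp, div_self hN]; simp only [div_eq_mul_inv, mul_inv]; ring

/-- The products of `Q_{10}` with the rows of the second eigenmatrix. -/
theorem secondEigenmatrix_one_zero_mul {i j x y : ℕ} (hr : 0 < r) (hk : k < n) (h0 : 0 < k)
    (hij : i + j ≤ k) (hj : j ≤ n - k) (hxy : x + y ≤ k) (hy : y ≤ n - k) :
    secondEigenmatrix r n k (1, 0) (x, y) * secondEigenmatrix r n k (i, j) (x, y) =
      (n : ℝ) * (i + 1) * (k - i - j) / (k * (n - i - 2 * j)) *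
          secondEigenmatrix r n k (i + 1, j) (x, y) +
        (if j = 0 then 0 else (n : ℝ) * (i + 1) * (n - k - j + 1) / (k * (n - i - 2 * j + 2))) *
          secondEigenmatrix r n k (i + 1, j - 1) (x, y) +
        (n : ℝ) * i * (r - 3) / k * secondEigenmatrix r n k (i, j) (x, y) +
        (if i = 0 then 0 else (n : ℝ) * (r - 2) * (n - i - j + 2) * (k - i - j + 1) /
          (k * (n - i - 2 * j + 2))) * secondEigenmatrix r n k (i - 1, j) (x, y) +
        (if i = 0 then 0 else (n : ℝ) * (r - 2) * (j + 1) * (n - k - j) /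
          (k * (n - i - 2 * j))) * secondEigenmatrix r n k (i - 1, j + 1) (x, y) := by
  have hxM : x ≤ k - y := by omega
  have h10 : secondEigenmatrix r n k (1, 0) (x, y) = (n : ℝ) / k * krawtchouk 1 (k - y) (r - 1) x := by
    simp only [secondEigenmatrix, Nat.choose_one_right]
    -- At `y = k` the Hahn factor is `0` by convention, but then `x = 0` and `K_1` is `0` too.
    by_cases hyk : y ≤ k - 1
    · rw [hahn_zero hyk (by omega), mul_one]
    · rw [krawtchouk_one hxM, show x = 0 by omega, show k - y = 0 by omega]
      simp
  have h3 := krawtchouk_one_mul hxM i (r - 1)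
  have hraise := eigenmatrix_raise (r := r) hk.le hij hj hxy h0
  have e : secondEigenmatrix r n k (1, 0) (x, y) * secondEigenmatrix r n k (i, j) (x, y) =
      (n : ℝ) / k * ((n.choose i : ℝ) / (k.choose i : ℝ) *
        (krawtchouk 1 (k - y) (r - 1) x * krawtchouk i (k - y) (r - 1) x) *
          hahn j (n - i) (k - i) y) := by
    rw [h10]
    simp only [secondEigenmatrix]
    ring
  have hlow : (n : ℝ) / k * ((n.choose i : ℝ) / (k.choose i : ℝ) * (if i = 0 then 0 else
      (((r - 1 : ℕ) : ℝ) - 1) * (((k - y : ℕ) : ℝ) - i + 1) *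
        krawtchouk (i - 1) (k - y) (r - 1) x) * hahn j (n - i) (k - i) y) =
      (if i = 0 then 0 else (n : ℝ) * (r - 2) * (n - i - j + 2) * (k - i - j + 1) /
          (k * (n - i - 2 * j + 2))) * secondEigenmatrix r n k (i - 1, j) (x, y) +
        (if i = 0 then 0 else (n : ℝ) * (r - 2) * (j + 1) * (n - k - j) /
          (k * (n - i - 2 * j))) * secondEigenmatrix r n k (i - 1, j + 1) (x, y) := by
    rcases i with _ | i
    · simp
    · rw [if_neg (by omega), if_neg (by omega), if_neg (by omega), Nat.add_sub_cancel]
      exact eigenmatrix_lower hr hk.le hij hj hxy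
  have hmid : (n : ℝ) / k * ((n.choose i : ℝ) / (k.choose i : ℝ) *
      ((i : ℝ) * (((r - 1 : ℕ) : ℝ) - 2) * krawtchouk i (k - y) (r - 1) x) *
        hahn j (n - i) (k - i) y) =
      (n : ℝ) * i * (r - 3) / k * secondEigenmatrix r n k (i, j) (x, y) := by
    simp only [secondEigenmatrix]
    rw [Nat.cast_sub (show 1 ≤ r from hr)]
    push_cast
    ring
  rw [e, h3]
  linear_combination hraise + hlow + hmid

/-- The products of `Q_{01}` with the rows of the second eigenmatrix. -/
theorem secondEigenmatrix_zero_one_mul {i j x y : ℕ} (hk : k < n) (h0 : 0 < k)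
    (hij : i + j ≤ k) (hj : j ≤ n - k) (hxy : x + y ≤ k) (hy : y ≤ n - k) :
    secondEigenmatrix r n k (0, 1) (x, y) * secondEigenmatrix r n k (i, j) (x, y) =
      (n : ℝ) * (n - 1) * (j + 1) * (k - i - j) * (n - k - j) /
          (k * (n - k) * (n - i - 2 * j) * (n - i - 2 * j - 1)) *
          secondEigenmatrix r n k (i, j + 1) (x, y) +
        ((n : ℝ) - 1 - n * (n - 1) / (k * (n - k) * (n - i - 2 * j + 1)) *
          (((k : ℝ) - i - j) * (n - i - j + 1) * (n - k - j) / (n - i - 2 * j) +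
            j * (k - i - j + 1) * (n - k - j + 1) / (n - i - 2 * j + 2))) *
          secondEigenmatrix r n k (i, j) (x, y) +
        (if j = 0 then 0 else (n : ℝ) * (n - 1) * (k - i - j + 1) * (n - i - j + 2) * (n - k - j + 1) /
          (k * (n - k) * (n - i - 2 * j + 2) * (n - i - 2 * j + 3))) *
          secondEigenmatrix r n k (i, j - 1) (x, y) := by
  have h01 : secondEigenmatrix r n k (0, 1) (x, y) =
      (n - 1) - (n : ℝ) * (n - 1) / (k * (n - k)) * y := by
    simp only [secondEigenmatrix, Nat.choose_zero_right, krawtchouk_zero, Nat.sub_zero]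
    rw [hahn_one h0 hk (by omega) hy]
    simp
  rw [h01]
  simp only [secondEigenmatrix]
  -- For `i > k - y` every term vanishes with `K_i`; otherwise `y ≤ k - i`, the range of the Hahn
  -- recurrence.
  by_cases hi : k - y < i
  · rw [krawtchouk_eq_zero (by omega) hi]; simp
  have h3 := hahn_three_term (N := n - i) (p := k - i) (j := j) (y := y) (by omega) (by omega)
    (by omega)
  rw [Nat.cast_sub (show i ≤ n by omega), Nat.cast_sub (show i ≤ k by omega)] at h3
  set c := (n.choose i : ℝ) / (k.choose i : ℝ) * krawtchouk i (k - y) (r - 1) x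
  have h4 : ∀ H : ℝ, ((n - 1) - (n : ℝ) * (n - 1) / (k * (n - k)) * y) * (c * H) =
      c * ((n - 1) * H - (n : ℝ) * (n - 1) / (k * (n - k)) * (y * H)) := fun H => by ring
  rw [h4, h3]
  rcases j with _ | j
  · simp only [if_true]; push_cast; simp only [div_eq_mul_inv, mul_inv]; ring
  · rw [if_neg (by omega), if_neg (by omega)]; push_cast; simp only [div_eq_mul_inv, mul_inv]; ring

/-! ### Reading off the Krein numbers -/

theorem kreinNumbers_one_zero (hr : 0 < r) (hk : k < n)
    (hQ : LinearIndependent ℝ fun (a b : domain n k) => secondEigenmatrix r n k a b)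
    {q : domain n k → domain n k → domain n k → ℝ}
    (hq : ∀ a b s : domain n k, secondEigenmatrix r n k a s * secondEigenmatrix r n k b s =
      ∑ c : domain n k, q a b c * secondEigenmatrix r n k c s)
    {i j : ℕ} (h₁ : (1, 0) ∈ domain n k) (ha : (i, j) ∈ domain n k) :
    q ⟨(1, 0), h₁⟩ ⟨(i, j), ha⟩ = fun c : domain n k =>
      (if (c : ℕ × ℕ) = (i + 1, j) then
        (n : ℝ) * (i + 1) * (k - i - j) / (k * (n - i - 2 * j)) else 0) +
      (if (c : ℕ × ℕ) = (i + 1, j - 1) then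
        (if j = 0 then 0 else (n : ℝ) * (i + 1) * (n - k - j + 1) / (k * (n - i - 2 * j + 2)))
        else 0) +
      (if (c : ℕ × ℕ) = (i, j) then (n : ℝ) * i * (r - 3) / k else 0) +
      (if (c : ℕ × ℕ) = (i - 1, j) then
        (if i = 0 then 0 else (n : ℝ) * (r - 2) * (n - i - j + 2) * (k - i - j + 1) /
          (k * (n - i - 2 * j + 2))) else 0) +
      (if (c : ℕ × ℕ) = (i - 1, j + 1) then
        (if i = 0 then 0 else (n : ℝ) * (r - 2) * (j + 1) * (n - k - j) /
          (k * (n - i - 2 * j))) else 0) := by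
  have h₁' := mem_domain.1 h₁
  have ha' := mem_domain.1 ha
  refine eq_of_sum_mul_eq hQ fun s => ?_
  rw [← hq]
  obtain ⟨⟨x, y⟩, hs⟩ := s
  have hs' := mem_domain.1 hs
  simp only [add_mul, Finset.sum_add_distrib]
  rw [secondEigenmatrix_one_zero_mul hr hk (by omega) (by omega) (by omega) (by omega) (by omega)]
  rw [sum_domain_ite (fun c => secondEigenmatrix r n k c (x, y)),
    sum_domain_ite (fun c => secondEigenmatrix r n k c (x, y)),
    sum_domain_ite (fun c => secondEigenmatrix r n k c (x, y)),
    sum_domain_ite (fun c => secondEigenmatrix r n k c (x, y)),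
    sum_domain_ite (fun c => secondEigenmatrix r n k c (x, y))]
  · intro h
    rw [mem_domain] at h
    split_ifs with h0
    · rfl
    -- Since `i ≥ 1`, the index `(i - 1, j + 1)` leaves `𝒟` only through `j = n - k`.
    have h1 : (n : ℝ) - k - j = 0 := by
      have : n = k + j := by omega
      rw [this]; push_cast; ring
    rw [h1]; simp
  · intro h
    rw [mem_domain] at h
    split_ifs with h0
    · rfl
    omega
  · intro h
    exact absurd ha h
  · intro h
    rw [mem_domain] at h
    split_ifs with h0
    · rfl
    omega
  · intro h
    rw [mem_domain] at h
    -- The index `(i + 1, j)` leaves `𝒟` only through `i + j = k`.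
    have h1 : (k : ℝ) - i - j = 0 := by
      have : k = i + j := by omega
      rw [this]; push_cast; ring
    rw [h1]; simp

theorem kreinNumbers_zero_one (hk : k < n)
    (hQ : LinearIndependent ℝ fun (a b : domain n k) => secondEigenmatrix r n k a b)
    {q : domain n k → domain n k → domain n k → ℝ}
    (hq : ∀ a b s : domain n k, secondEigenmatrix r n k a s * secondEigenmatrix r n k b s =
      ∑ c : domain n k, q a b c * secondEigenmatrix r n k c s)
    {i j : ℕ} (h₁ : (0, 1) ∈ domain n k) (ha : (i, j) ∈ domain n k) :
    q ⟨(0, 1), h₁⟩ ⟨(i, j), ha⟩ = fun c : domain n k =>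
      (if (c : ℕ × ℕ) = (i, j + 1) then (n : ℝ) * (n - 1) * (j + 1) * (k - i - j) * (n - k - j) /
          (k * (n - k) * (n - i - 2 * j) * (n - i - 2 * j - 1)) else 0) +
      (if (c : ℕ × ℕ) = (i, j) then
        ((n : ℝ) - 1 - n * (n - 1) / (k * (n - k) * (n - i - 2 * j + 1)) *
          (((k : ℝ) - i - j) * (n - i - j + 1) * (n - k - j) / (n - i - 2 * j) +
            j * (k - i - j + 1) * (n - k - j + 1) / (n - i - 2 * j + 2))) else 0) +
      (if (c : ℕ × ℕ) = (i, j - 1) then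
        (if j = 0 then 0 else (n : ℝ) * (n - 1) * (k - i - j + 1) * (n - i - j + 2) *
          (n - k - j + 1) / (k * (n - k) * (n - i - 2 * j + 2) * (n - i - 2 * j + 3)))
        else 0) := by
  have h₁' := mem_domain.1 h₁
  have ha' := mem_domain.1 ha
  refine eq_of_sum_mul_eq hQ fun s => ?_
  rw [← hq]
  obtain ⟨⟨x, y⟩, hs⟩ := s
  have hs' := mem_domain.1 hs
  simp only [add_mul, Finset.sum_add_distrib]
  rw [secondEigenmatrix_zero_one_mul hk (by omega) (by omega) (by omega) (by omega) (by omega)]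
  rw [sum_domain_ite (fun c => secondEigenmatrix r n k c (x, y)),
    sum_domain_ite (fun c => secondEigenmatrix r n k c (x, y)),
    sum_domain_ite (fun c => secondEigenmatrix r n k c (x, y))]
  · intro h
    rw [mem_domain] at h
    split_ifs with h0
    · rfl
    omega
  · intro h
    exact absurd ha h
  · intro h
    rw [mem_domain] at h
    -- The index `(i, j + 1)` leaves `𝒟` through either bound, and the coefficient has a zero factor
    -- for each.
    by_cases h2 : k = i + j
    · have h1 : (k : ℝ) - i - j = 0 := by
        rw [h2]; push_cast; ring
      rw [h1]; simp
    · have h1 : (n : ℝ) - k - j = 0 := by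
        have : n = k + j := by omega
        rw [this]; push_cast; ring
      rw [h1]; simp

/-- Truncated subtraction makes `(i + 1, j - 1)` or `(i - 1, j)` coincide with another index only
for `j = 0` or `i = 0`, where the guarded coefficient is `0`. -/
theorem eval_five_ite {i j s t : ℕ} {C₁ C₂ C₃ C₄ C₅ W : ℝ}
    (hW : W = (if ((s, t) : ℕ × ℕ) = (i + 1, j) then C₁ else 0) +
      (if ((s, t) : ℕ × ℕ) = (i + 1, j - 1) then (if j = 0 then 0 else C₂) else 0) +
      (if ((s, t) : ℕ × ℕ) = (i, j) then C₃ else 0) +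
      (if ((s, t) : ℕ × ℕ) = (i - 1, j) then (if i = 0 then 0 else C₄) else 0) +
      (if ((s, t) : ℕ × ℕ) = (i - 1, j + 1) then (if i = 0 then 0 else C₅) else 0)) :
    (W ≠ 0 → (s = i + 1 ∧ t = j) ∨ (s = i + 1 ∧ t + 1 = j) ∨ (s = i ∧ t = j) ∨
      (s + 1 = i ∧ t = j) ∨ (s + 1 = i ∧ t = j + 1)) ∧
    (s = i ∧ t = j → W = C₃) ∧ (s = i + 1 ∧ t = j → W = C₁) ∧ (s = i + 1 ∧ t + 1 = j → W = C₂) ∧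
    (s + 1 = i ∧ t = j → W = C₄) ∧ (s + 1 = i ∧ t = j + 1 → W = C₅) := by
  simp only [Prod.mk.injEq] at hW
  subst hW
  refine ⟨fun h => ?_, ?_, ?_, ?_, ?_, ?_⟩
  · by_contra hcon
    apply h
    split_ifs <;> first | omega | simp
  all_goals
    rintro ⟨rfl, rfl⟩
    split_ifs <;> first | omega | contradiction | simp

theorem eval_three_ite {i j s t : ℕ} {C₁ C₂ C₃ W : ℝ}
    (hW : W = (if ((s, t) : ℕ × ℕ) = (i, j + 1) then C₁ else 0) +
      (if ((s, t) : ℕ × ℕ) = (i, j) then C₂ else 0) +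
      (if ((s, t) : ℕ × ℕ) = (i, j - 1) then (if j = 0 then 0 else C₃) else 0)) :
    (W ≠ 0 → (s = i ∧ t = j + 1) ∨ (s = i ∧ t = j) ∨ (s = i ∧ t + 1 = j)) ∧
    (s = i ∧ t = j → W = C₂) ∧ (s = i ∧ t + 1 = j → W = C₃) ∧ (s = i ∧ t = j + 1 → W = C₁) := by
  simp only [Prod.mk.injEq] at hW
  subst hW
  refine ⟨fun h => ?_, ?_, ?_, ?_⟩
  · by_contra hcon
    apply h
    split_ifs <;> first | omega | simp
  all_goals
    rintro ⟨rfl, rfl⟩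
    split_ifs <;> first | omega | contradiction | simp

end NonbinaryJohnson

/-! ### The main theorem -/

theorem proposition4p1 (r n k : ℕ) (hr : 2 < r) (hk : k < n) :
    -- the scheme and its labelled primitive idempotents
    IsSymmetricAssociationScheme (relation r n k) ∧
    EnumeratesPrimitiveIdempotents (relation r n k) (idempotent r n k) ∧
    -- its Krein numbers
    ∃ q : domain n k → domain n k → domain n k → ℝ,
      (∀ q' : domain n k → domain n k → domain n k → ℝ,
        IsKreinNumbers (idempotent r n k) q' ↔ q' = q) ∧
      -- part (i)
      (∀ (i j s t : ℕ) (h₁ : (1, 0) ∈ domain n k) (ha : (i, j) ∈ domain n k)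
          (hb : (s, t) ∈ domain n k),
        (q ⟨(1, 0), h₁⟩ ⟨(i, j), ha⟩ ⟨(s, t), hb⟩ ≠ 0 →
          ((s : ℤ), (t : ℤ)) ∈ ({((i : ℤ) + 1, (j : ℤ)), ((i : ℤ) + 1, (j : ℤ) - 1),
            ((i : ℤ), (j : ℤ)), ((i : ℤ) - 1, (j : ℤ) + 1), ((i : ℤ) - 1, (j : ℤ))} :
              Set (ℤ × ℤ)) ∧
          GrlexLE (s, t) (i + 1, j)) ∧
        (s = i ∧ t = j → q ⟨(1, 0), h₁⟩ ⟨(i, j), ha⟩ ⟨(s, t), hb⟩ =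
          (n : ℝ) * i * ((r : ℝ) - 3) / k) ∧
        (s = i + 1 ∧ t = j → q ⟨(1, 0), h₁⟩ ⟨(i, j), ha⟩ ⟨(s, t), hb⟩ =
          (n : ℝ) * ((i : ℝ) + 1) * ((k : ℝ) - i - j) / ((k : ℝ) * ((n : ℝ) - i - 2 * j))) ∧
        (s = i + 1 ∧ t + 1 = j → q ⟨(1, 0), h₁⟩ ⟨(i, j), ha⟩ ⟨(s, t), hb⟩ =
          (n : ℝ) * ((i : ℝ) + 1) * ((n : ℝ) - k - j + 1) /
            ((k : ℝ) * ((n : ℝ) - i - 2 * j + 2))) ∧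
        (s + 1 = i ∧ t = j → q ⟨(1, 0), h₁⟩ ⟨(i, j), ha⟩ ⟨(s, t), hb⟩ =
          (n : ℝ) * ((r : ℝ) - 2) * ((n : ℝ) - i - j + 2) * ((k : ℝ) - i - j + 1) /
            ((k : ℝ) * ((n : ℝ) - i - 2 * j + 2))) ∧
        (s + 1 = i ∧ t = j + 1 → q ⟨(1, 0), h₁⟩ ⟨(i, j), ha⟩ ⟨(s, t), hb⟩ =
          (n : ℝ) * ((r : ℝ) - 2) * ((j : ℝ) + 1) * ((n : ℝ) - k - j) /
            ((k : ℝ) * ((n : ℝ) - i - 2 * j))) ∧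
        (s = i + 1 ∧ t = j → q ⟨(1, 0), h₁⟩ ⟨(i, j), ha⟩ ⟨(s, t), hb⟩ ≠ 0)) ∧
      -- part (ii)
      (∀ (i j s t : ℕ) (h₁ : (0, 1) ∈ domain n k) (ha : (i, j) ∈ domain n k)
          (hb : (s, t) ∈ domain n k),
        (q ⟨(0, 1), h₁⟩ ⟨(i, j), ha⟩ ⟨(s, t), hb⟩ ≠ 0 →
          ((s : ℤ), (t : ℤ)) ∈ ({((i : ℤ), (j : ℤ) + 1), ((i : ℤ), (j : ℤ)),
            ((i : ℤ), (j : ℤ) - 1)} : Set (ℤ × ℤ)) ∧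
          GrlexLE (s, t) (i, j + 1)) ∧
        -- for `n = i + 2 * j` the first inner fraction is `0 / 0`, read as `0`
        (s = i ∧ t = j → q ⟨(0, 1), h₁⟩ ⟨(i, j), ha⟩ ⟨(s, t), hb⟩ =
          (n : ℝ) - 1 - (n : ℝ) * ((n : ℝ) - 1) /
              ((k : ℝ) * ((n : ℝ) - k) * ((n : ℝ) - i - 2 * j + 1)) *
            (((k : ℝ) - i - j) * ((n : ℝ) - i - j + 1) * ((n : ℝ) - k - j) /
                ((n : ℝ) - i - 2 * j) +
              (j : ℝ) * ((k : ℝ) - i - j + 1) * ((n : ℝ) - k - j + 1) /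
                ((n : ℝ) - i - 2 * j + 2))) ∧
        (s = i ∧ t + 1 = j → q ⟨(0, 1), h₁⟩ ⟨(i, j), ha⟩ ⟨(s, t), hb⟩ =
          (n : ℝ) * ((n : ℝ) - 1) * ((k : ℝ) - i - j + 1) * ((n : ℝ) - i - j + 2) *
              ((n : ℝ) - k - j + 1) /
            ((k : ℝ) * ((n : ℝ) - k) * ((n : ℝ) - i - 2 * j + 2) *
              ((n : ℝ) - i - 2 * j + 3))) ∧
        (s = i ∧ t = j + 1 → q ⟨(0, 1), h₁⟩ ⟨(i, j), ha⟩ ⟨(s, t), hb⟩ =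
          (n : ℝ) * ((n : ℝ) - 1) * ((j : ℝ) + 1) * ((k : ℝ) - i - j) * ((n : ℝ) - k - j) /
            ((k : ℝ) * ((n : ℝ) - k) * ((n : ℝ) - i - 2 * j) *
              ((n : ℝ) - i - 2 * j - 1))) ∧
        (s = i ∧ t = j + 1 → q ⟨(0, 1), h₁⟩ ⟨(i, j), ha⟩ ⟨(s, t), hb⟩ ≠ 0)) := by
  have hmem := idempotent_mem (r := r) (n := n) (k := k)
  have hmul := idempotent_mul hr hk.le
  have hne := idempotent_ne_zero hr hk.le
  have := nonempty_vertex hr hk.le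
  have hQ : LinearIndependent ℝ fun (a b : domain n k) => secondEigenmatrix r n k a b :=
    linearIndependent_rows (fun _ => rfl) (linearIndependent_of_orthogonal hmul hne)
  have hkrein := isKreinNumbers_iff (E := idempotent r n k)
    (Q := fun (a b : domain n k) => secondEigenmatrix r n k a b) (fun _ => rfl)
    (surjective_of_orthogonal hmem hmul hne)
  refine ⟨isSymmetricAssociationScheme_of_orthogonal hmem hmul hne ⟨_, adjacency_zero_eq_one⟩
    relation_comm, enumeratesPrimitiveIdempotents_of_orthogonal hmem hmul hne, ?_⟩
  obtain ⟨q, hq⟩ := exists_kreinNumbers hQ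
  refine ⟨q, fun q' => ?_, ?_, ?_⟩
  · rw [hkrein]
    constructor
    · intro h
      funext a b
      exact eq_of_sum_mul_eq hQ fun s => by rw [← h, ← hq]
    · rintro rfl
      exact hq
  · intro i j s t h₁ ha hb
    have h₁' := mem_domain.1 h₁
    have hb' := mem_domain.1 hb
    obtain ⟨w0, w1, w2, w3, w4, w5⟩ := eval_five_ite (congrFun
      (kreinNumbers_one_zero (by omega) hk hQ hq h₁ ha) ⟨(s, t), hb⟩)
    refine ⟨fun h => ?_, w1, w2, w3, w4, w5, fun hst => ?_⟩
    · have hcase := w0 h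
      simp only [Set.mem_insert_iff, Set.mem_singleton_iff, Prod.mk.injEq, GrlexLE]
      omega
    · rw [w2 hst]
      obtain ⟨rfl, rfl⟩ := hst
      -- Membership of `(i + 1, t)` in `𝒟` gives `i + t < k` and `t ≤ n - k`, hence `i + 2 t < n`.
      have e1 : (k : ℝ) - i - t ≠ 0 := by
        have : (i : ℝ) + t + 1 ≤ k := by exact_mod_cast (show i + t + 1 ≤ k by omega)
        linarith
      have e2 : (n : ℝ) - i - 2 * t ≠ 0 := by
        have : (i : ℝ) + 2 * t + 1 ≤ n := by exact_mod_cast (show i + 2 * t + 1 ≤ n by omega)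
        linarith
      have e3 : (n : ℝ) ≠ 0 := by exact_mod_cast (show n ≠ 0 by omega)
      have e4 : (k : ℝ) ≠ 0 := by exact_mod_cast (show k ≠ 0 by omega)
      have e5 : (i : ℝ) + 1 ≠ 0 := by positivity
      positivity
  · intro i j s t h₁ ha hb
    have h₁' := mem_domain.1 h₁
    have hb' := mem_domain.1 hb
    obtain ⟨w0, w1, w2, w3⟩ := eval_three_ite (congrFun
      (kreinNumbers_zero_one hk hQ hq h₁ ha) ⟨(s, t), hb⟩)
    refine ⟨fun h => ?_, w1, w2, w3, fun hst => ?_⟩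
    · have hcase := w0 h
      simp only [Set.mem_insert_iff, Set.mem_singleton_iff, Prod.mk.injEq, GrlexLE]
      omega
    · rw [w3 hst]
      obtain ⟨rfl, rfl⟩ := hst
      -- Membership of `(s, j + 1)` in `𝒟` gives `s + j + 1 ≤ k` and `j + 1 ≤ n - k`, so no factor
      -- above or below vanishes.
      have e1 : (k : ℝ) - s - j ≠ 0 := by
        have : (s : ℝ) + j + 1 ≤ k := by exact_mod_cast (show s + j + 1 ≤ k by omega)
        linarith
      have e6 : (n : ℝ) - k - j ≠ 0 := by
        have : (k : ℝ) + j + 1 ≤ n := by exact_mod_cast (show k + j + 1 ≤ n by omega)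
        linarith
      have e7 : (s : ℝ) + 2 * j + 2 ≤ n := by exact_mod_cast (show s + 2 * j + 2 ≤ n by omega)
      have e2 : (n : ℝ) - s - 2 * j ≠ 0 := by linarith
      have e8 : (n : ℝ) - s - 2 * j - 1 ≠ 0 := by linarith
      have e3 : (n : ℝ) ≠ 0 := by exact_mod_cast (show n ≠ 0 by omega)
      have e4 : (k : ℝ) ≠ 0 := by exact_mod_cast (show k ≠ 0 by omega)
      have e5 : (j : ℝ) + 1 ≠ 0 := by positivity
      have e9 : (n : ℝ) - 1 ≠ 0 := by
        have : (2 : ℝ) ≤ n := by exact_mod_cast (show 2 ≤ n by omega)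
        linarith
      have e10 : (n : ℝ) - k ≠ 0 := by
        have : (k : ℝ) + 1 ≤ n := by exact_mod_cast hk
        linarith
      positivity
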